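/- Let $\Bbbk=\mathbb R$ or $\mathbb C$, and let $A=\bigoplus_{n\in\mathbb Z}A^n$ be a differential graded algebra over $\Bbbk$ with product $\wedge$ (associative, not necessarily unital or graded commutative) and differential $\mathfrak d$ of degree $1$. Let $\langle\cdot,\cdot\rangle$ be a Euclidean (resp. Hermitian) positive definite metric on $A$ for which $\mathfrak d$ has a formal adjoint $\mathfrak d^*$ of degree $-1$, i.e. $\langle \mathfrak d a,b\rangle=\langle a,\mathfrak d^*b\rangle$. Put $\square=\mathfrak d\mathfrak d^*+\mathfrak d^*\mathfrak d$ and $\mathcal H=\ker\square$, and assume the Hodge decomposition $$A=\mathcal H\oplus\operatorname{Im}\mathfrak d\oplus\operatorname{Im}\mathfrak d^*.$$ Let $a\mapsto a^H$ be the projection onto $\mathcal H$ along $\operatorname{Im}\mathfrak d\oplus\operatorname{Im}\mathfrak d^*$. Let $G$ be the Green operator, which is $0$ on $\mathcal H$ and is the inverse of $\square$ on $\operatorname{Im}\mathfrak d\oplus\operatorname{Im}\mathfrak d^*$. Put $Q=G\mathfrak d^*$ and $[\mathfrak d,Q]=\mathfrak dQ+Q\mathfrak d$. For homogeneous $v_i\in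 A$ define $\lambda_2(v_1,v_2)=v_1\wedge v_2$ and, for $n\ge3$, $$\begin{aligned}\lambda_n(v_1,\dots,v_n)={}&(-1)^{n-1}Q\lambda_{n-1}(v_1,\dots,v_{n-1})\wedge v_n-(-1)^{n|v_1|}v_1\wedge Q\lambda_{n-1}(v_2,\dots,v_n)\\&-\sum_{k+l=n,\;k,l\ge2}(-1)^{k+(l-1)(|v_1|+\dots+|v_k|)}\,Q\lambda_k(v_1,\dots,v_k)\wedge Q\lambda_l(v_{k+1},\dots,v_n).\end{aligned}$$ An $A_\infty$ structure on a $\mathbb Z$-graded vector space $V$ is a sequence of linear maps $m_k:V^{\otimes k}\to V$, $k\ge1$, of degree $2-k$, such that for all $n\ge1$ and all homogeneous $v_1,\dots,v_n\in V$ $$\sum_{\substack{k+l=n+1\\k,l\ge1}}\ \sum_{j=0}^{k-1}(-1)^{j+l(n-j-l)+l(|v_1|+\dots+|v_j|)}\,m_k\bigl(v_1,\dots,v_j,m_l(v_{j+1},\dots,v_{j+l}),v_{j+l+1},\dots,v_n\bigr)=0 .$$ **Theorem.** (1) The map $\phi:\mathcal H\to H(A,\mathfrak d)=\ker\mathfrak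 d/\operatorname{Im}\mathfrak d$, $\phi(\alpha)=[\alpha]$, is an isomorphism of graded vector spaces, and $\phi(\alpha\circ\beta)=\phi(\alpha)\wedge\phi(\beta)$, where $\alpha\circ\beta=(\alpha\wedge\beta)^H$ and $\wedge$ on $H(A,\mathfrak d)$ is the induced wedge product $[a]\wedge[b]=[a\wedge b]$. (2) There is exactly one $A_\infty$ structure $(m_k)$ on $\mathcal H$ with $m_1=\mathfrak d|_{\mathcal H}$ and $m_k(\alpha_1,\dots,\alpha_k)=(1-[\mathfrak d,Q])\lambda_k(\alpha_1,\dots,\alpha_k)$ for all $k\ge2$ and all homogeneous $\alpha_i\in\mathcal H$; it satisfies $m_2=\circ$. (3) The transport of this structure through $\phi$, that is, the sequence of maps determined by $m_k(\phi(\alpha_1),\dots,\phi(\alpha_k))=\phi(m_k(\alpha_1,\dots,\alpha_k))$ for $k\ge1$, is an $A_\infty$ structure on $H(A,\mathfrak d)$ with $m_1=0$ and with $m_2$ the induced wedge product. -/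

import Mathlib

/-- A differential graded algebra structure over `𝕜` (not necessarily unital or commutative) on a
`ℤ`-graded associative `𝕜`-algebra `A = ⨁ n, 𝒜 n`: a differential of degree `1` that is a graded
derivation. -/
structure DGA (𝕜 : Type*) {A : Type*} [RCLike 𝕜] [NonUnitalRing A] [Module 𝕜 A]
    [IsScalarTower 𝕜 A A] [SMulCommClass 𝕜 A A]
    (𝒜 : ℤ → Submodule 𝕜 A) [DirectSum.Decomposition 𝒜] [SetLike.GradedMul 𝒜] where
  d : A →ₗ[𝕜] A
  d_mem : ∀ (n : ℤ) (a : A), a ∈ 𝒜 n → d a ∈ 𝒜 (n + 1)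
  d_d : ∀ a : A, d (d a) = 0
  leibniz : ∀ (n : ℤ) (a b : A), a ∈ 𝒜 n → d (a * b) = d a * b + n.negOnePow • (a * d b)

/-- A differential graded algebra with a Euclidean or Hermitian metric (a positive definite inner
product over `𝕜 = ℝ` or `ℂ`), a formal adjoint `dstar` of `d`, of degree `-1`, and a Hodge
decomposition `A = ker (d dstar + dstar d) ⊕ im d ⊕ im dstar`. -/
structure HodgeDGA (𝕜 : Type*) {A : Type*} [RCLike 𝕜] [NonUnitalRing A] [Module 𝕜 A]
    [IsScalarTower 𝕜 A A] [SMulCommClass 𝕜 A A]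
    (𝒜 : ℤ → Submodule 𝕜 A) [DirectSum.Decomposition 𝒜] [SetLike.GradedMul 𝒜]
    extends DGA 𝕜 𝒜 where
  metric : InnerProductSpace.Core 𝕜 A
  dstar : A →ₗ[𝕜] A
  dstar_mem : ∀ (n : ℤ) (a : A), a ∈ 𝒜 n → dstar a ∈ 𝒜 (n - 1)
  adjoint : ∀ a b : A, metric.inner (d a) b = metric.inner a (dstar b)
  hodge : DirectSum.IsInternal
    ![LinearMap.ker (d ∘ₗ dstar + dstar ∘ₗ d), LinearMap.range d, LinearMap.range dstar]

/-- An `A∞` structure on a `ℤ`-graded vector space `V = ⨁ n, 𝒱 n`: linear maps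
`m k : V ^ ⊗ k → V` of degree `2 - k` for `k ≥ 1` (given as multilinear maps; the unused `m 0` is
set to `0`), with, for every `n ≥ 1` and homogeneous `v₁, …, vₙ`,
`∑ (-1) ^ (j + l (n - j - l) + l (|v₁| + ⋯ + |vⱼ|))
  m k (v₁, …, vⱼ, m l (vⱼ₊₁, …, vⱼ₊ₗ), vⱼ₊ₗ₊₁, …, vₙ) = 0`,
the sum being over `k, l ≥ 1` with `k + l = n + 1` and `0 ≤ j < k`.
In the code the arguments are numbered from `0`. -/
structure AInfinityStructure {𝕜 V : Type*} [Field 𝕜] [AddCommGroup V] [Module 𝕜 V]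
    (𝒱 : ℤ → Submodule 𝕜 V) where
  isInternal : DirectSum.IsInternal 𝒱
  m : (k : ℕ) → MultilinearMap 𝕜 (fun _ : Fin k => V) V
  m_zero : m 0 = 0
  m_mem : ∀ (k : ℕ), 1 ≤ k → ∀ (p : Fin k → ℤ) (v : Fin k → V), (∀ i, v i ∈ 𝒱 (p i)) →
    m k v ∈ 𝒱 ((∑ i, p i) + 2 - k)
  relation : ∀ (n : ℕ), 1 ≤ n → ∀ (p : ℕ → ℤ) (v : ℕ → V), (∀ i < n, v i ∈ 𝒱 (p i)) →
    ∑ l ∈ Finset.Icc 1 n, ∑ j ∈ Finset.range (n + 1 - l),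
      ((j : ℤ) + l * ((n : ℤ) - j - l) + l * ∑ i ∈ Finset.range j, p i).negOnePow •
        m (n + 1 - l) (fun i : Fin (n + 1 - l) =>
          if (i : ℕ) < j then v i
          else if (i : ℕ) = j then m l (fun s : Fin l => v (j + s))
          else v (i + l - 1)) = 0

namespace DGA

variable {𝕜 A : Type*} [RCLike 𝕜] [NonUnitalRing A] [Module 𝕜 A]
  [IsScalarTower 𝕜 A A] [SMulCommClass 𝕜 A A]
  {𝒜 : ℤ → Submodule 𝕜 A} [DirectSum.Decomposition 𝒜] [SetLike.GradedMul 𝒜]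
  (D : DGA 𝕜 𝒜)

/-- The space of cocycles. -/
abbrev cocycles : Submodule 𝕜 A := LinearMap.ker D.d

/-- The space of coboundaries, as a subspace of the cocycles. -/
abbrev coboundaries : Submodule 𝕜 D.cocycles := (LinearMap.range D.d).comap D.cocycles.subtype

/-- The cohomology `H(A, d) = ker d / im d`. -/
abbrev Cohomology : Type _ := D.cocycles ⧸ D.coboundaries

/-- The cohomology class of a cocycle. -/
abbrev cls : D.cocycles →ₗ[𝕜] D.Cohomology := D.coboundaries.mkQ

/-- The degree `n` part of the cohomology: classes of cocycles of degree `n`. -/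
def cohGrading (n : ℤ) : Submodule 𝕜 D.Cohomology :=
  ((𝒜 n).comap D.cocycles.subtype).map D.cls

/-- The grading involution `a ↦ (-1) ^ n a` for `a` of degree `n`. -/
noncomputable def invol : A →ₗ[𝕜] A :=
  DirectSum.toModule 𝕜 ℤ A (fun n => n.negOnePow • (𝒜 n).subtype) ∘ₗ
    (DirectSum.decomposeLinearEquiv 𝒜).toLinearMap

lemma invol_of_mem {n : ℤ} {a : A} (ha : a ∈ 𝒜 n) :
    invol (𝕜 := 𝕜) (𝒜 := 𝒜) a = n.negOnePow • a := by
  have h : DirectSum.decomposeLinearEquiv (R := 𝕜) 𝒜 a = DirectSum.lof 𝕜 ℤ _ n ⟨a, ha⟩ :=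
    DirectSum.decompose_of_mem 𝒜 ha
  simp [invol, h]

lemma invol_invol (a : A) :
    invol (𝕜 := 𝕜) (𝒜 := 𝒜) (invol (𝕜 := 𝕜) (𝒜 := 𝒜) a) = a := by
  induction a using DirectSum.Decomposition.inductionOn 𝒜 with
  | zero => simp
  | homogeneous a =>
    rename_i n
    rw [invol_of_mem a.2, invol_of_mem ((𝒜 n).smul_of_tower_mem _ a.2), smul_smul,
      ← Int.negOnePow_add, Int.negOnePow_even _ ⟨n, rfl⟩, one_smul]
  | add a b ha hb => rw [map_add, map_add, ha, hb]

lemma d_invol (a : A) :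
    D.d (invol (𝕜 := 𝕜) (𝒜 := 𝒜) a) = - invol (𝕜 := 𝕜) (𝒜 := 𝒜) (D.d a) := by
  induction a using DirectSum.Decomposition.inductionOn 𝒜 with
  | zero => simp
  | homogeneous a =>
    rw [invol_of_mem a.2, invol_of_mem (D.d_mem _ _ a.2), Int.negOnePow_succ, Units.smul_def,
      Units.smul_def, map_zsmul]
    simp
  | add a b ha hb => simp only [map_add, ha, hb, neg_add]

lemma leibniz_invol (a b : A) :
    D.d (a * b) = D.d a * b + invol (𝕜 := 𝕜) (𝒜 := 𝒜) a * D.d b := by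
  induction a using DirectSum.Decomposition.inductionOn 𝒜 with
  | zero => simp
  | homogeneous a =>
    rw [D.leibniz _ _ _ a.2, invol_of_mem a.2, Units.smul_def, Units.smul_def, smul_mul_assoc]
  | add x y hx hy =>
    rw [add_mul, map_add, map_add, map_add, hx, hy, add_mul, add_mul]
    abel

lemma mul_mem_cocycles {a b : A} (ha : a ∈ D.cocycles) (hb : b ∈ D.cocycles) :
    a * b ∈ D.cocycles := by
  rw [LinearMap.mem_ker] at *
  rw [D.leibniz_invol, ha, hb, zero_mul, mul_zero, add_zero]

/-- The product of cocycles. -/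
def cocycleMul : D.cocycles →ₗ[𝕜] D.cocycles →ₗ[𝕜] D.cocycles :=
  LinearMap.mk₂ 𝕜 (fun a b => ⟨a * b, D.mul_mem_cocycles a.2 b.2⟩)
    (fun _ _ _ => Subtype.ext (add_mul _ _ _)) (fun _ _ _ => Subtype.ext (smul_mul_assoc _ _ _))
    (fun _ _ _ => Subtype.ext (mul_add _ _ _)) (fun _ _ _ => Subtype.ext (mul_smul_comm _ _ _))

lemma cocycleMul_left (a b : D.cocycles) (ha : a ∈ D.coboundaries) :
    D.cocycleMul a b ∈ D.coboundaries := by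
  obtain ⟨x, hx⟩ := ha
  refine ⟨x * b, ?_⟩
  have hb : D.d b = 0 := b.2
  rw [D.leibniz_invol, hb, mul_zero, add_zero, hx]
  rfl

lemma cocycleMul_right (a b : D.cocycles) (hb : b ∈ D.coboundaries) :
    D.cocycleMul a b ∈ D.coboundaries := by
  obtain ⟨x, hx⟩ := hb
  refine ⟨invol (𝕜 := 𝕜) (𝒜 := 𝒜) a * x, ?_⟩
  have ha : D.d a = 0 := a.2
  rw [D.leibniz_invol, D.d_invol, ha, invol_invol, hx, map_zero, neg_zero, zero_mul, zero_add]
  rfl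

/-- The product induced on cohomology, `[a] [b] = [a b]`. -/
def cohMul : D.Cohomology →ₗ[𝕜] D.Cohomology →ₗ[𝕜] D.Cohomology :=
  D.coboundaries.liftQ
    (LinearMap.flip (D.coboundaries.liftQ (D.cocycleMul.compr₂ D.cls).flip (by
      intro b hb
      ext a
      exact (Submodule.Quotient.mk_eq_zero _).2 (D.cocycleMul_right a b hb)))) (by
    intro a ha
    ext b
    exact (Submodule.Quotient.mk_eq_zero _).2 (D.cocycleMul_left a b ha))

lemma cohMul_cls (a b : D.cocycles) :
    D.cohMul (D.cls a) (D.cls b) = D.cls ⟨a * b, D.mul_mem_cocycles a.2 b.2⟩ := rfl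

end DGA

namespace HodgeDGA

variable {𝕜 A : Type*} [RCLike 𝕜] [NonUnitalRing A] [Module 𝕜 A]
  [IsScalarTower 𝕜 A A] [SMulCommClass 𝕜 A A]
  {𝒜 : ℤ → Submodule 𝕜 A} [DirectSum.Decomposition 𝒜] [SetLike.GradedMul 𝒜]
  (D : HodgeDGA 𝕜 𝒜)

/-- The Laplacian `□ = d d* + d* d`. -/
abbrev laplacian : A →ₗ[𝕜] A := D.d ∘ₗ D.dstar + D.dstar ∘ₗ D.d

/-- The space `ℋ = ker □` of harmonic elements. -/
abbrev harmonic : Submodule 𝕜 A := LinearMap.ker D.laplacian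

/-- The degree `n` part of the space of harmonic elements. -/
def harmonicGrading (n : ℤ) : Submodule 𝕜 D.harmonic := (𝒜 n).comap D.harmonic.subtype

lemma adjoint' (a b : A) : D.metric.inner (D.dstar a) b = D.metric.inner a (D.d b) := by
  rw [← D.metric.conj_inner_symm, ← D.adjoint, D.metric.conj_inner_symm]

lemma eq_of_inner {a b : A} (h : ∀ c, D.metric.inner c a = D.metric.inner c b) : a = b := by
  have h1 : D.metric.inner (a - b) (a - b) = 0 :=
    (@InnerProductSpace.Core.inner_sub_right 𝕜 A _ _ _ D.metric.toCore (a - b) a b).trans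
      (sub_eq_zero.2 (h (a - b)))
  exact sub_eq_zero.1 (D.metric.definite _ h1)

lemma dstar_dstar (a : A) : D.dstar (D.dstar a) = 0 := by
  refine D.eq_of_inner fun c => ?_
  rw [← D.adjoint, ← D.adjoint, D.d_d]
  exact (@InnerProductSpace.Core.inner_zero_left 𝕜 A _ _ _ D.metric.toCore a).trans
    (@InnerProductSpace.Core.inner_zero_right 𝕜 A _ _ _ D.metric.toCore c).symm

lemma harmonic_closed {a : A} (ha : a ∈ D.harmonic) : D.d a = 0 ∧ D.dstar a = 0 := by
  have h0 : D.d (D.dstar a) + D.dstar (D.d a) = 0 := ha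
  have h1 : D.metric.inner (D.dstar a) (D.dstar a) + D.metric.inner (D.d a) (D.d a) = 0 := by
    rw [D.adjoint', D.adjoint]
    refine (@InnerProductSpace.Core.inner_add_right 𝕜 A _ _ _ D.metric.toCore a _ _).symm.trans ?_
    rw [h0]
    exact @InnerProductSpace.Core.inner_zero_right 𝕜 A _ _ _ D.metric.toCore a
  have key : ∀ x : A, RCLike.re (D.metric.inner x x) = 0 → x = 0 := fun x hx => by
    refine D.metric.definite x (RCLike.ext ?_ ?_)
    · rw [map_zero]; exact hx
    · rw [map_zero]; exact @InnerProductSpace.Core.inner_self_im 𝕜 A _ _ _ D.metric.toCore x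
  have h2 := congrArg RCLike.re h1
  rw [map_add, map_zero] at h2
  have p1 := D.metric.re_inner_nonneg (D.dstar a)
  have p2 := D.metric.re_inner_nonneg (D.d a)
  exact ⟨key _ (by linarith), key _ (by linarith)⟩

/-- `im d ⊕ im d*`. -/
abbrev exactPart : Submodule 𝕜 A := LinearMap.range D.d ⊔ LinearMap.range D.dstar

lemma isCompl : IsCompl D.harmonic D.exactPart := by
  have h1 := D.hodge.submodule_iSupIndep 0
  have h2 := D.hodge.submodule_iSup_eq_top
  have h3 : (⨆ j : Fin 3, ⨆ _ : j ≠ 0,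
      (![LinearMap.ker (D.d ∘ₗ D.dstar + D.dstar ∘ₗ D.d), LinearMap.range D.d,
        LinearMap.range D.dstar] : Fin 3 → Submodule 𝕜 A) j) = D.exactPart := by
    apply le_antisymm
    · refine iSup₂_le fun j hj => ?_
      fin_cases j
      · exact absurd rfl hj
      · exact le_sup_left
      · exact le_sup_right
    · refine sup_le ?_ ?_
      · exact le_iSup₂_of_le (1 : Fin 3) (by decide) le_rfl
      · exact le_iSup₂_of_le (2 : Fin 3) (by decide) le_rfl
  rw [h3] at h1
  refine ⟨h1, codisjoint_iff_le_sup.2 ?_⟩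
  rw [← h2]
  refine iSup_le fun j => ?_
  fin_cases j
  · exact le_sup_left
  · exact le_sup_of_le_right le_sup_left
  · exact le_sup_of_le_right le_sup_right

lemma exists_hodge (a : A) : ∃ h x y, h ∈ D.harmonic ∧ a = h + (D.d x + D.dstar y) := by
  have hs : a ∈ D.harmonic ⊔ D.exactPart := by rw [D.isCompl.sup_eq_top]; trivial
  obtain ⟨h, hh, e, he, rfl⟩ := Submodule.mem_sup.1 hs
  obtain ⟨_, ⟨x, rfl⟩, _, ⟨y, rfl⟩, rfl⟩ := Submodule.mem_sup.1 he
  exact ⟨h, x, y, hh, rfl⟩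

/-- The Laplacian restricted to `im d ⊕ im d*`. -/
def laplacianExact : D.exactPart →ₗ[𝕜] D.exactPart :=
  (D.laplacian ∘ₗ D.exactPart.subtype).codRestrict D.exactPart fun a =>
    Submodule.add_mem_sup ⟨D.dstar a, rfl⟩ ⟨D.d a, rfl⟩

lemma laplacianExact_bijective : Function.Bijective D.laplacianExact := by
  constructor
  · rw [← LinearMap.ker_eq_bot, LinearMap.ker_eq_bot']
    intro a ha
    have h : (a : A) ∈ D.harmonic := congrArg Subtype.val ha
    exact Subtype.ext (Submodule.disjoint_def.1 D.isCompl.disjoint _ h a.2)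
  · rintro ⟨e, he⟩
    obtain ⟨_, ⟨a, rfl⟩, _, ⟨b, rfl⟩, rfl⟩ := Submodule.mem_sup.1 he
    obtain ⟨h, x, y, hh, rfl⟩ := D.exists_hodge a
    obtain ⟨k, z, w, hk, rfl⟩ := D.exists_hodge b
    obtain ⟨h', x', y', hh', rfl⟩ := D.exists_hodge y
    obtain ⟨k', z', w', hk', rfl⟩ := D.exists_hodge z
    have e1 := D.harmonic_closed hh
    have e2 := D.harmonic_closed hh'
    have e3 := D.harmonic_closed hk
    have e4 := D.harmonic_closed hk'
    refine ⟨⟨D.d x' + D.dstar w', Submodule.add_mem_sup ⟨_, rfl⟩ ⟨_, rfl⟩⟩, Subtype.ext ?_⟩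
    simp [laplacianExact, D.d_d, D.dstar_dstar, e1.1, e2.2, e3.2, e4.1]

/-- The inverse `□⁻¹` of the Laplacian on `im d ⊕ im d*`. -/
noncomputable def laplacianInv : D.exactPart →ₗ[𝕜] D.exactPart :=
  (LinearEquiv.ofBijective D.laplacianExact D.laplacianExact_bijective).symm.toLinearMap

/-- The projection `a ↦ a ^ H` onto the harmonic elements along `im d ⊕ im d*`. -/
noncomputable def harmonicProj : A →ₗ[𝕜] D.harmonic :=
  D.harmonic.projectionOnto D.exactPart D.isCompl

/-- Green's operator: the projection onto `im d ⊕ im d*` along `ℋ`, followed by `□⁻¹`. -/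
noncomputable def green : A →ₗ[𝕜] A :=
  D.exactPart.subtype ∘ₗ D.laplacianInv ∘ₗ
    D.exactPart.projectionOnto D.harmonic D.isCompl.symm

/-- The operator `Q = G d*`, of degree `-1`. -/
noncomputable def Q : A →ₗ[𝕜] A := D.green ∘ₗ D.dstar

/-- The operator `1 - [d, Q]`, where `[d, Q] = d Q + Q d` is the supercommutator. -/
noncomputable def oneSubComm : A →ₗ[𝕜] A :=
  LinearMap.id - (D.d ∘ₗ D.Q + D.Q ∘ₗ D.d)

/-- The multiplication `a ∘ b = (a b) ^ H` on the harmonic elements. -/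
noncomputable def circ (a b : D.harmonic) : D.harmonic := D.harmonicProj ((a : A) * (b : A))

/-- Merkulov's maps: `D.lam n p v` is `λₙ(v₀, …, vₙ₋₁)` for homogeneous `vᵢ` of degree `p i`:
`λ₂(v₀, v₁) = v₀ v₁` and, for `N = n + 3`,
`λ_N(v₀, …) = (-1) ^ (N - 1) Q λ_{N-1}(v₀, …) v_{N-1} - (-1) ^ (N |v₀|) v₀ Q λ_{N-1}(v₁, …)
  - ∑ (-1) ^ (k + (l - 1) (|v₀| + ⋯ + |v_{k-1}|)) Q λ_k(v₀, …) Q λ_l(v_k, …)`,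
the sum being over `k, l ≥ 2` with `k + l = N` (in the code `k = i + 2` and `l = n + 1 - i`). -/
noncomputable def lam : (n : ℕ) → (ℕ → ℤ) → (ℕ → A) → A
  | 0, _, _ => 0
  | 1, _, _ => 0
  | 2, _, v => v 0 * v 1
  | n + 3, p, v =>
    ((n : ℤ) + 2).negOnePow • (D.Q (lam (n + 2) p v) * v (n + 2))
    - (((n : ℤ) + 3) * p 0).negOnePow •
        (v 0 * D.Q (lam (n + 2) (fun i => p (1 + i)) (fun i => v (1 + i))))
    - ∑ i : Fin n,
        (((i : ℤ) + 2) + ((n : ℤ) - i) * ∑ s ∈ Finset.range (i + 2), p s).negOnePow •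
          (D.Q (lam (i + 2) p v) *
            D.Q (lam (n + 1 - i) (fun s => p (i + 2 + s)) (fun s => v (i + 2 + s))))
  termination_by n => n
  decreasing_by all_goals omega

/-- An `A∞` structure on `ℋ` is Merkulov's if `m₁` is the restriction of `d` and
`m_k = (1 - [d, Q]) λ_k` for `k ≥ 2`. -/
def IsMerkulov (M : AInfinityStructure D.harmonicGrading) : Prop :=
  (∀ a : Fin 1 → D.harmonic, (M.m 1 a : A) = D.d (a 0)) ∧
  ∀ (k : ℕ), 2 ≤ k → ∀ (p : ℕ → ℤ) (a : ℕ → D.harmonic),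
    (∀ i < k, a i ∈ D.harmonicGrading (p i)) →
      (M.m k (fun i => a i) : A) = D.oneSubComm (D.lam k p (fun i => (a i : A)))

/-- The map `φ : ℋ → H(A, d)`, `a ↦ [a]`. -/
def harmonicToCoh : D.harmonic →ₗ[𝕜] D.Cohomology :=
  D.cls ∘ₗ Submodule.inclusion fun _ ha => (D.harmonic_closed ha).1

end HodgeDGA

/-!
Let `P = 1 - [d, Q]`. Since `Q = G d*` and `G` commutes with `d`, one has `[d, Q] = G □`, so `P` is
the harmonic projection (`HodgeDGA.oneSubComm_apply`). A closed element `a` equals `P a + d Q a`,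
hence its class has a unique harmonic representative, which settles the statements about `φ`. The
operators involved respect degrees because `d`, `d*` and the Hodge decomposition do.

For the `A∞` relations, put `q₁ = -id` and `qₙ = Q λₙ`. Merkulov's recursion then has the uniform
shape `λₙ = ∑ ± q_k ⊗ q_l`, the sum being over all `k + l = n` (`HodgeDGA.lam_eq`). After
desuspension, that is, after multiplying by the sign with exponent `suspExp`, all signs become
Koszul signs of operators of odd degree: on words of homogeneous elements `λ = q * q` for the
convolution product dual to cutting words in two (`HodgeDGA.wlam_eq_convSq`), and the `A∞` relation
for `m = P λ` says that `m ∘ m̂ = 0`, where `m̂` is the coderivation induced by `m`, written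
`insertOp m m = 0`.

The heart of the matter is `d λ = -λ ∘ m̂` on words of closed elements
(`HodgeDGA.IsClosedWord.d_wlam`), proved by induction on the length. From `d Q = 1 - P - Q d` and
the identity for shorter words one gets `d q = λ + q ∘ m̂`. The Leibniz rule for `d` turns
`d (q * q)` into `(q * q) * q - q * (q * q)`, which vanishes by associativity (`convSq_assoc`), plus
terms containing `q ∘ m̂`; by the Leibniz rule for the coderivation (`insertOp_convSq`) the latter
add up to `-(q * q) ∘ m̂`. Applying `P`, which kills exact elements, yields `m ∘ m̂ = 0`.

The formula for `m` makes sense for homogeneous arguments of given degrees. There it is multilinear,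
and a multilinear map on a graded space is the same as a family of such maps indexed by the degrees
of the arguments; this gives existence and uniqueness of the structure on `ℋ`.
-/

/-! ### Homogeneous components -/

section Components

variable {𝕜 A : Type*} [RCLike 𝕜] [AddCommGroup A] [Module 𝕜 A]
  (𝒜 : ℤ → Submodule 𝕜 A) [DirectSum.Decomposition 𝒜]

/-- The projection of `A = ⨁ n, 𝒜 n` onto its degree `n` part, as an endomorphism of `A`. -/
noncomputable def degProj (n : ℤ) : A →ₗ[𝕜] A :=
  (𝒜 n).subtype ∘ₗ DirectSum.component 𝕜 ℤ (fun i => 𝒜 i) n ∘ₗ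
    (DirectSum.decomposeLinearEquiv 𝒜).toLinearMap

lemma degProj_mem (n : ℤ) (a : A) : degProj 𝒜 n a ∈ 𝒜 n :=
  (DirectSum.decompose 𝒜 a n).2

lemma degProj_of_mem {n : ℤ} {a : A} (ha : a ∈ 𝒜 n) : degProj 𝒜 n a = a :=
  DirectSum.decompose_of_mem_same 𝒜 ha

lemma degProj_of_mem_ne {m n : ℤ} {a : A} (ha : a ∈ 𝒜 m) (h : m ≠ n) : degProj 𝒜 n a = 0 :=
  DirectSum.decompose_of_mem_ne 𝒜 ha h

lemma degProj_map {f : A →ₗ[𝕜] A} {c : ℤ} (hf : ∀ n, ∀ a ∈ 𝒜 n, f a ∈ 𝒜 (n + c))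
    (n : ℤ) (a : A) : degProj 𝒜 (n + c) (f a) = f (degProj 𝒜 n a) := by
  induction a using DirectSum.Decomposition.inductionOn 𝒜 with
  | zero => simp
  | @homogeneous m a =>
    by_cases h : m = n
    · subst h
      rw [degProj_of_mem 𝒜 a.2, degProj_of_mem 𝒜 (hf _ _ a.2)]
    · rw [degProj_of_mem_ne 𝒜 a.2 h, degProj_of_mem_ne 𝒜 (hf _ _ a.2) (by omega), map_zero]
  | add a b ha hb => simp only [map_add, ha, hb]

/-- A subspace stable under taking homogeneous components inherits the grading. -/
lemma isInternal_comap_subtype {W : Submodule 𝕜 A} (hW : ∀ n, ∀ a ∈ W, degProj 𝒜 n a ∈ W) :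
    DirectSum.IsInternal (fun n => (𝒜 n).comap W.subtype) := by
  classical
  rw [DirectSum.isInternal_submodule_iff_iSupIndep_and_iSup_eq_top]
  have hA := (DirectSum.Decomposition.isInternal 𝒜).submodule_iSupIndep
  constructor
  · intro n
    rw [Submodule.disjoint_def]
    intro x hx hx'
    refine Subtype.ext (Submodule.disjoint_def.1 (hA n) x hx ?_)
    have h : ((⨆ j, ⨆ _ : j ≠ n, (𝒜 j).comap W.subtype).map W.subtype) ≤
        ⨆ j, ⨆ _ : j ≠ n, 𝒜 j := by
      simp only [Submodule.map_iSup]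
      exact iSup₂_mono fun j _ => Submodule.map_comap_le _ _
    exact h ⟨x, hx', rfl⟩
  · rw [eq_top_iff]
    rintro ⟨a, ha⟩ -
    have h : (⟨a, ha⟩ : W) =
        ∑ n ∈ (DirectSum.decompose 𝒜 a).support, ⟨degProj 𝒜 n a, hW n a ha⟩ := by
      refine Subtype.ext ?_
      rw [AddSubmonoidClass.coe_finsetSum]
      exact (DirectSum.sum_support_decompose 𝒜 a).symm
    rw [h]
    exact sum_mem fun n _ => Submodule.mem_iSup_of_mem n (degProj_mem 𝒜 n a)

end Components

lemma DirectSum.IsInternal.map_linearEquiv {𝕜 V W : Type*} [Ring 𝕜] [AddCommGroup V] [Module 𝕜 V]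
    [AddCommGroup W] [Module 𝕜 W] {𝒱 : ℤ → Submodule 𝕜 V} (h : DirectSum.IsInternal 𝒱)
    (e : V ≃ₗ[𝕜] W) : DirectSum.IsInternal (fun n => (𝒱 n).map e.toLinearMap) := by
  rw [DirectSum.isInternal_submodule_iff_iSupIndep_and_iSup_eq_top] at h ⊢
  refine ⟨h.1.map_orderIso (Submodule.orderIsoMapComap e), ?_⟩
  rw [← Submodule.map_iSup, h.2, Submodule.map_top, LinearEquiv.range]

/-! ### The harmonic projection and Green's operator -/

namespace HodgeDGA

variable {𝕜 A : Type*} [RCLike 𝕜] [NonUnitalRing A] [Module 𝕜 A]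
  [IsScalarTower 𝕜 A A] [SMulCommClass 𝕜 A A]
  {𝒜 : ℤ → Submodule 𝕜 A} [DirectSum.Decomposition 𝒜] [SetLike.GradedMul 𝒜]
  (D : HodgeDGA 𝕜 𝒜)

lemma sub_harmonicProj_mem (a : A) : a - D.harmonicProj a ∈ D.exactPart := by
  have h : D.harmonicProj (a - D.harmonicProj a) = 0 := by
    rw [map_sub, harmonicProj, Submodule.projectionOnto_apply_left, sub_self]
  exact (Submodule.projectionOnto_apply_eq_zero_iff D.isCompl).1 h

lemma harmonicProj_eq {a h : A} (hh : h ∈ D.harmonic) (ha : a - h ∈ D.exactPart) :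
    (D.harmonicProj a : A) = h := by
  have e : D.harmonicProj (a - h) = 0 :=
    (Submodule.projectionOnto_apply_eq_zero_iff D.isCompl).2 ha
  rw [map_sub, harmonicProj, Submodule.projectionOnto_apply_of_mem_left D.isCompl hh,
    sub_eq_zero] at e
  exact congrArg Subtype.val e

lemma harmonicProj_of_mem {a : A} (ha : a ∈ D.harmonic) : (D.harmonicProj a : A) = a :=
  D.harmonicProj_eq ha (by simp)

lemma harmonicProj_d (a : A) : D.harmonicProj (D.d a) = 0 :=
  (Submodule.projectionOnto_apply_eq_zero_iff D.isCompl).2 (Submodule.mem_sup_left ⟨a, rfl⟩)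

lemma green_mem (a : A) : D.green a ∈ D.exactPart := Subtype.coe_prop _

lemma laplacian_green (a : A) : D.laplacian (D.green a) = a - D.harmonicProj a := by
  have h1 : ∀ e : D.exactPart, D.laplacian (D.laplacianInv e) = e := fun e =>
    congrArg Subtype.val
      ((LinearEquiv.ofBijective D.laplacianExact D.laplacianExact_bijective).apply_symm_apply e)
  have h2 : D.exactPart.projectionOnto D.harmonic D.isCompl.symm a =
      ⟨a - D.harmonicProj a, D.sub_harmonicProj_mem a⟩ := by
    conv_lhs => rw [← add_sub_cancel (D.harmonicProj a : A) a]
    rw [map_add, Submodule.projectionOnto_apply_right D.isCompl.symm, zero_add,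
      Submodule.projectionOnto_apply_of_mem_left]
  exact (h1 _).trans (congrArg Subtype.val h2)

lemma eq_of_laplacian_eq {a b : A} (ha : a ∈ D.exactPart) (hb : b ∈ D.exactPart)
    (h : D.laplacian a = D.laplacian b) : a = b := by
  rw [← sub_eq_zero]
  refine Submodule.disjoint_def.1 D.isCompl.disjoint _ ?_ (sub_mem ha hb)
  rw [LinearMap.mem_ker, map_sub, h, sub_self]

lemma green_eq {a g : A} (hg : g ∈ D.exactPart) (h : D.laplacian g = a - D.harmonicProj a) :
    D.green a = g :=
  D.eq_of_laplacian_eq (D.green_mem a) hg ((D.laplacian_green a).trans h.symm)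

lemma d_green (a : A) : D.d (D.green a) = D.green (D.d a) := by
  refine (D.green_eq (Submodule.mem_sup_left ⟨_, rfl⟩) ?_).symm
  have h := congrArg D.d (D.laplacian_green a)
  simp only [LinearMap.add_apply, LinearMap.comp_apply, map_add, D.d_d, zero_add, map_sub,
    (D.harmonic_closed (D.harmonicProj a).2).1, sub_zero] at h
  rw [harmonicProj_d]
  simpa [D.d_d] using h

/-- The operator `1 - [d, Q]` is the harmonic projection, because `[d, Q] = G □`. -/
lemma oneSubComm_apply (a : A) : D.oneSubComm a = D.harmonicProj a := by
  have h : D.green (D.laplacian a) = a - D.harmonicProj a := by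
    refine D.green_eq (D.sub_harmonicProj_mem a) ?_
    have h1 : D.laplacian (D.harmonicProj a) = 0 := (D.harmonicProj a).2
    have h2 : D.harmonicProj (D.laplacian a) = 0 :=
      (Submodule.projectionOnto_apply_eq_zero_iff D.isCompl).2
        (Submodule.add_mem_sup ⟨_, rfl⟩ ⟨_, rfl⟩)
    rw [map_sub, h1, h2]
    simp
  have h' : D.d (D.Q a) + D.Q (D.d a) = a - D.harmonicProj a := by
    rw [← h]
    simp only [Q, LinearMap.comp_apply, LinearMap.add_apply, map_add, D.d_green]
  simp only [oneSubComm, LinearMap.sub_apply, LinearMap.id_apply, LinearMap.add_apply,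
    LinearMap.comp_apply, h']
  abel

lemma d_Q (a : A) : D.d (D.Q a) = a - D.harmonicProj a - D.Q (D.d a) := by
  rw [← D.oneSubComm_apply]
  simp only [oneSubComm, LinearMap.sub_apply, LinearMap.id_apply, LinearMap.add_apply,
    LinearMap.comp_apply]
  abel

lemma degProj_d (n : ℤ) (a : A) : degProj 𝒜 n (D.d a) = D.d (degProj 𝒜 (n - 1) a) := by
  simpa using degProj_map 𝒜 (c := 1) D.d_mem (n - 1) a

lemma degProj_dstar (n : ℤ) (a : A) :
    degProj 𝒜 n (D.dstar a) = D.dstar (degProj 𝒜 (n + 1) a) := by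
  simpa using degProj_map 𝒜 (c := -1) D.dstar_mem (n + 1) a

lemma degProj_laplacian (n : ℤ) (a : A) :
    degProj 𝒜 n (D.laplacian a) = D.laplacian (degProj 𝒜 n a) := by
  simp [degProj_d, degProj_dstar]

lemma degProj_mem_harmonic (n : ℤ) {a : A} (ha : a ∈ D.harmonic) :
    degProj 𝒜 n a ∈ D.harmonic := by
  rw [LinearMap.mem_ker] at ha ⊢
  rw [← degProj_laplacian, ha, map_zero]

lemma degProj_mem_exactPart (n : ℤ) {a : A} (ha : a ∈ D.exactPart) :
    degProj 𝒜 n a ∈ D.exactPart := by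
  obtain ⟨_, ⟨x, rfl⟩, _, ⟨y, rfl⟩, rfl⟩ := Submodule.mem_sup.1 ha
  rw [map_add, degProj_d, degProj_dstar]
  exact Submodule.add_mem_sup ⟨_, rfl⟩ ⟨_, rfl⟩

lemma degProj_harmonicProj (n : ℤ) (a : A) :
    (D.harmonicProj (degProj 𝒜 n a) : A) = degProj 𝒜 n (D.harmonicProj a) := by
  refine D.harmonicProj_eq (D.degProj_mem_harmonic n (D.harmonicProj a).2) ?_
  rw [← map_sub]
  exact D.degProj_mem_exactPart n (D.sub_harmonicProj_mem a)

lemma harmonicProj_mem {n : ℤ} {a : A} (ha : a ∈ 𝒜 n) : (D.harmonicProj a : A) ∈ 𝒜 n := by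
  rw [← degProj_of_mem 𝒜 ha, degProj_harmonicProj]
  exact degProj_mem 𝒜 n _

lemma green_mem_of_mem {n : ℤ} {a : A} (ha : a ∈ 𝒜 n) : D.green a ∈ 𝒜 n := by
  have h : D.green (degProj 𝒜 n a) = degProj 𝒜 n (D.green a) := by
    refine D.green_eq (D.degProj_mem_exactPart n (D.green_mem a)) ?_
    rw [← degProj_laplacian, laplacian_green, map_sub, degProj_harmonicProj]
  rw [← degProj_of_mem 𝒜 ha, h]
  exact degProj_mem 𝒜 n _

lemma Q_mem {n : ℤ} {a : A} (ha : a ∈ 𝒜 n) : D.Q a ∈ 𝒜 (n - 1) :=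
  D.green_mem_of_mem (D.dstar_mem n a ha)

lemma isInternal_harmonicGrading : DirectSum.IsInternal D.harmonicGrading :=
  isInternal_comap_subtype 𝒜 fun n _ ha => D.degProj_mem_harmonic n ha

/-! ### Harmonic representatives of cohomology classes -/

/-- A closed element differs from its harmonic part by the coboundary `d Q a`. -/
lemma harmonicToCoh_harmonicProj (a : D.toDGA.cocycles) :
    D.harmonicToCoh (D.harmonicProj a) = D.cls a := by
  refine (Submodule.Quotient.eq _).2 ?_
  have ha : D.d (a : A) = 0 := a.2
  refine ⟨-D.Q a, ?_⟩
  have h := D.d_Q a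
  rw [ha, map_zero, sub_zero] at h
  rw [map_neg, h]
  exact neg_sub _ _

lemma harmonicToCoh_bijective : Function.Bijective D.harmonicToCoh := by
  constructor
  · rw [← LinearMap.ker_eq_bot, LinearMap.ker_eq_bot']
    intro a ha
    obtain ⟨x, hx⟩ := (Submodule.Quotient.mk_eq_zero _).1 ha
    have hx : D.d x = a := hx
    refine Subtype.ext ?_
    rw [← D.harmonicProj_of_mem a.2, ← hx, harmonicProj_d]
  · intro x
    obtain ⟨a, rfl⟩ := Submodule.mkQ_surjective _ x
    exact ⟨_, D.harmonicToCoh_harmonicProj a⟩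

lemma map_harmonicGrading (n : ℤ) :
    (D.harmonicGrading n).map D.harmonicToCoh = D.cohGrading n := by
  apply le_antisymm
  · rintro _ ⟨a, ha, rfl⟩
    exact ⟨⟨a, (D.harmonic_closed a.2).1⟩, ha, rfl⟩
  · rintro _ ⟨a, ha, rfl⟩
    exact ⟨D.harmonicProj a, D.harmonicProj_mem ha, D.harmonicToCoh_harmonicProj a⟩

lemma harmonicToCoh_circ (a b : D.harmonic) :
    D.harmonicToCoh (D.circ a b) = D.cohMul (D.harmonicToCoh a) (D.harmonicToCoh b) := by
  have ha := (D.harmonic_closed a.2).1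
  have hb := (D.harmonic_closed b.2).1
  exact D.harmonicToCoh_harmonicProj ⟨a * b, D.mul_mem_cocycles ha hb⟩

end HodgeDGA

/-! ### Sums over the ways of cutting a word in two -/

section SplitSum

variable {X M : Type*} [AddCommGroup M]

/-- The sum of `F u v` over all ways of cutting the word `w` as `w = u ++ v`. -/
def splitSum (F : List X → List X → M) (w : List X) : M :=
  ∑ i ∈ Finset.range (w.length + 1), F (w.take i) (w.drop i)

lemma splitSum_nil (F : List X → List X → M) : splitSum F [] = F [] [] := by
  simp [splitSum]

lemma splitSum_cons (F : List X → List X → M) (x : X) (w : List X) :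
    splitSum F (x :: w) = F [] (x :: w) + splitSum (fun u v => F (x :: u) v) w := by
  rw [splitSum, Finset.sum_range_succ', add_comm]
  rfl

lemma splitSum_congr {F G : List X → List X → M} {w : List X}
    (h : ∀ u v, u ++ v = w → F u v = G u v) : splitSum F w = splitSum G w :=
  Finset.sum_congr rfl fun _ _ => h _ _ (List.take_append_drop _ _)

lemma splitSum_add (F G : List X → List X → M) (w : List X) :
    splitSum (fun u v => F u v + G u v) w = splitSum F w + splitSum G w :=
  Finset.sum_add_distrib

lemma splitSum_sub (F G : List X → List X → M) (w : List X) :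
    splitSum (fun u v => F u v - G u v) w = splitSum F w - splitSum G w :=
  Finset.sum_sub_distrib _ _

lemma map_splitSum {N : Type*} [AddCommGroup N] (f : M →+ N) (F : List X → List X → M)
    (w : List X) : f (splitSum F w) = splitSum (fun u v => f (F u v)) w :=
  map_sum f _ _

lemma smul_splitSum (c : ℤ) (F : List X → List X → M) (w : List X) :
    c • splitSum F w = splitSum (fun u v => c • F u v) w :=
  Finset.smul_sum

lemma units_smul_splitSum (c : ℤˣ) (F : List X → List X → M) (w : List X) :
    c • splitSum F w = splitSum (fun u v => c • F u v) w :=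
  Finset.smul_sum

lemma splitSum_neg (F : List X → List X → M) (w : List X) :
    splitSum (fun u v => -F u v) w = -splitSum F w :=
  Finset.sum_neg_distrib _

lemma splitSum_comm (F : List X → List X → List X → List X → M) (w z : List X) :
    splitSum (fun u v => splitSum (fun a b => F u v a b) z) w =
      splitSum (fun a b => splitSum (fun u v => F u v a b) w) z :=
  Finset.sum_comm

lemma mul_splitSum {R : Type*} [NonUnitalRing R] (a : R) (F : List X → List X → R) (w : List X) :
    a * splitSum F w = splitSum (fun u v => a * F u v) w :=
  Finset.mul_sum _ _ _

lemma splitSum_mul {R : Type*} [NonUnitalRing R] (a : R) (F : List X → List X → R) (w : List X) :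
    splitSum F w * a = splitSum (fun u v => F u v * a) w :=
  Finset.sum_mul _ _ _

/-- Both sides are the sum of `F a b c` over all `w = a ++ b ++ c`. -/
lemma splitSum_assoc (F : List X → List X → List X → M) (w : List X) :
    splitSum (fun a t => splitSum (fun b c => F a b c) t) w =
      splitSum (fun t c => splitSum (fun a b => F a b c) t) w := by
  induction w generalizing F with
  | nil => simp only [splitSum_nil]
  | cons x w ih =>
    simp only [splitSum_cons, splitSum_nil, splitSum_add, add_assoc, ih]

/-- The word `u ++ c :: y` is cut either before or after the letter `c`. -/
lemma splitSum_append_cons (F : List X → List X → M) (u : List X) (c : X) (y : List X) :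
    splitSum F (u ++ c :: y) =
      splitSum (fun a b => F a (b ++ c :: y)) u + splitSum (fun a b => F (u ++ c :: a) b) y := by
  induction u generalizing F with
  | nil => simp only [List.nil_append, splitSum_cons, splitSum_nil]
  | cons x u ih => simp only [List.cons_append, splitSum_cons, ih, add_assoc]

end SplitSum

/-! ### Words of homogeneous elements and insertion operators -/

section Words

variable {A : Type*}

/-- The total degree of a word, a letter being an element of `A` paired with its degree. -/
def wordDeg (w : List (ℤ × A)) : ℤ := (w.map Prod.fst).sum

/-- The Koszul sign `(-1) ^ (∑ (|vᵢ| - 1))` of moving an operator of odd degree past the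
desuspension of the word `v₁ ⋯ vₙ`. -/
def wordSign (w : List (ℤ × A)) : ℤˣ := (wordDeg w + w.length).negOnePow

lemma wordDeg_cons (x : ℤ × A) (w : List (ℤ × A)) : wordDeg (x :: w) = x.1 + wordDeg w := by
  simp [wordDeg]

lemma wordDeg_append (u v : List (ℤ × A)) : wordDeg (u ++ v) = wordDeg u + wordDeg v := by
  simp [wordDeg]

lemma wordSign_append (u v : List (ℤ × A)) : wordSign (u ++ v) = wordSign u * wordSign v := by
  rw [wordSign, wordSign, wordSign, ← Int.negOnePow_add, wordDeg_append, List.length_append]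
  congr 1
  push_cast
  ring

lemma wordSign_mul_self (u : List (ℤ × A)) : wordSign u * wordSign u = 1 :=
  Int.units_mul_self _

/-- The exponent `∑ (n - i) |vᵢ| + n + 1` of the sign by which desuspension changes an operation
at the word `v₁ ⋯ vₙ`. -/
def suspExp : List (ℤ × A) → ℤ
  | [] => 1
  | x :: w => suspExp w + w.length * x.1 + 1

lemma suspExp_append (u v : List (ℤ × A)) :
    suspExp (u ++ v) = suspExp u + suspExp v + v.length * wordDeg u - 1 := by
  induction u with
  | nil => simp [suspExp, wordDeg]
  | cons x u ih =>
    rw [List.cons_append, suspExp, ih, suspExp, wordDeg_cons, List.length_append]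
    push_cast
    ring

/-- The word with letters `v 0, …, v (n - 1)` of degrees `p 0, …, p (n - 1)`. -/
def seqWord (p : ℕ → ℤ) (v : ℕ → A) (n : ℕ) : List (ℤ × A) :=
  (List.range n).map fun i => (p i, v i)

lemma length_seqWord (p : ℕ → ℤ) (v : ℕ → A) (n : ℕ) : (seqWord p v n).length = n := by
  simp [seqWord]

lemma seqWord_add (p : ℕ → ℤ) (v : ℕ → A) (m n : ℕ) : seqWord p v (m + n) =
    seqWord p v m ++ seqWord (fun i => p (m + i)) (fun i => v (m + i)) n := by
  simp [seqWord, List.range_add]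

/-- The letter `m x` with the degree that a homogeneous operation of degree `2 - k` gives it, where
`k` is the length of the word `x`. -/
def opLetter (m : List (ℤ × A) → A) (x : List (ℤ × A)) : ℤ × A :=
  (wordDeg x + 2 - x.length, m x)

lemma wordSign_append_opLetter (m : List (ℤ × A) → A) (u x a : List (ℤ × A)) :
    wordSign (u ++ opLetter m x :: a) = -(wordSign (u ++ (x ++ a))) := by
  rw [wordSign, wordSign, ← Int.negOnePow_succ, Int.negOnePow_eq_iff]
  simp only [wordDeg_append, wordDeg_cons, List.length_append, List.length_cons, opLetter]
  push_cast
  exact ⟨1 - x.length, by ring⟩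

variable [NonUnitalRing A]

/-- The value of `f` on the image of the word `w` under the coderivation of the tensor coalgebra
induced by `m`: the sum of `± f (u ++ m x :: y)` over `w = u ++ x ++ y` with `x` of length at least
`2`, the sign being that of moving the odd operation past `u`. -/
def insertOp (m f : List (ℤ × A) → A) (w : List (ℤ × A)) : A :=
  splitSum (fun u t => splitSum (fun x y =>
    (if 2 ≤ x.length then (1 : ℤ) else 0) • wordSign u • f (u ++ opLetter m x :: y)) t) w

/-- The twisted convolution square of `g`, on words. -/
def convSq (g : List (ℤ × A) → A) (w : List (ℤ × A)) : A :=
  splitSum (fun u v => wordSign u • (g u * g v)) w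

/-- Leibniz rule: the coderivation induced by `m` is compatible with the convolution product. -/
lemma insertOp_convSq (m g : List (ℤ × A) → A) (w : List (ℤ × A)) :
    insertOp m (convSq g) w =
      splitSum (fun u v => g u * insertOp m g v) w -
        splitSum (fun u v => wordSign u • (insertOp m g u * g v)) w := by
  set χ : List (ℤ × A) → ℤ := fun x => if 2 ≤ x.length then 1 else 0
  have h1 : insertOp m (convSq g) w =
      splitSum (fun u t => splitSum (fun a b => splitSum (fun x y =>
        χ x • wordSign b • (g a * g (b ++ opLetter m x :: y))) t) u) w -
      splitSum (fun u t => splitSum (fun x y => splitSum (fun a b =>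
        χ x • wordSign (u ++ (x ++ a)) • wordSign u • (g (u ++ opLetter m x :: a) * g b)) y) t)
        w := by
    rw [insertOp, ← splitSum_sub]
    refine splitSum_congr fun u t _ => ?_
    rw [splitSum_comm, ← splitSum_sub]
    refine splitSum_congr fun x y _ => ?_
    rw [convSq, splitSum_append_cons, smul_add, smul_add, units_smul_splitSum, smul_splitSum,
      units_smul_splitSum, smul_splitSum, sub_eq_add_neg, ← splitSum_neg]
    congr 1
    · refine splitSum_congr fun a b hab => ?_
      rw [← hab, wordSign_append, smul_smul (wordSign a * wordSign b), mul_right_comm,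
        wordSign_mul_self, one_mul]
    · refine splitSum_congr fun a b _ => ?_
      rw [wordSign_append_opLetter, smul_comm (wordSign u), Units.neg_smul, smul_neg]
  rw [h1]
  congr 1
  -- the cut lies to the left of the inserted letter
  · rw [← splitSum_assoc]
    refine splitSum_congr fun a z _ => ?_
    rw [insertOp, mul_splitSum]
    refine splitSum_congr fun b t _ => ?_
    rw [mul_splitSum]
    refine splitSum_congr fun x y _ => ?_
    rw [mul_smul_comm, mul_smul_comm]
  -- the cut lies to the right of the inserted letter
  · have h2 : ∀ u t : List (ℤ × A), splitSum (fun x y => splitSum (fun a b =>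
        χ x • wordSign (u ++ (x ++ a)) • wordSign u • (g (u ++ opLetter m x :: a) * g b)) y) t =
        splitSum (fun r b => splitSum (fun x a =>
        χ x • wordSign (u ++ (x ++ a)) • wordSign u • (g (u ++ opLetter m x :: a) * g b)) r) t :=
      fun u t => splitSum_assoc (fun x a b =>
        χ x • wordSign (u ++ (x ++ a)) • wordSign u • (g (u ++ opLetter m x :: a) * g b)) t
    simp only [h2]
    rw [splitSum_assoc]
    refine splitSum_congr fun r b _ => ?_
    rw [insertOp, splitSum_mul, units_smul_splitSum]
    refine splitSum_congr fun u t hr => ?_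
    rw [splitSum_mul, units_smul_splitSum]
    refine splitSum_congr fun x a ht => ?_
    rw [ht, hr, smul_mul_assoc, smul_mul_assoc]
    exact smul_comm _ _ _

/-- The two ways of bracketing a triple convolution product cancel, by associativity of `A`. -/
lemma convSq_assoc (g : List (ℤ × A) → A) (w : List (ℤ × A)) :
    splitSum (fun u v => wordSign u • (convSq g u * g v)) w =
      splitSum (fun u v => g u * convSq g v) w := by
  have h1 : ∀ u v : List (ℤ × A), wordSign u • (convSq g u * g v) =
      splitSum (fun a b => wordSign b • (g a * (g b * g v))) u := fun u v => by
    rw [convSq, splitSum_mul, units_smul_splitSum]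
    refine splitSum_congr fun a b hab => ?_
    rw [← hab, wordSign_append, smul_mul_assoc, smul_smul, mul_right_comm, wordSign_mul_self,
      one_mul, mul_assoc]
  simp only [h1]
  rw [← splitSum_assoc]
  refine splitSum_congr fun a t _ => ?_
  rw [convSq, mul_splitSum]
  exact splitSum_congr fun b v _ => (mul_smul_comm _ _ _).symm

lemma insertOp_sub (m f g : List (ℤ × A) → A) (w : List (ℤ × A)) :
    insertOp m (fun u => f u - g u) w = insertOp m f w - insertOp m g w := by
  simp only [insertOp, smul_sub, splitSum_sub]

lemma map_insertOp (m f : List (ℤ × A) → A) (φ : A →+ A) (w : List (ℤ × A)) :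
    φ (insertOp m f w) = insertOp m (fun u => φ (f u)) w := by
  simp only [insertOp, map_splitSum, map_zsmul, map_zsmul_unit]

/-- The function on words that is the identity on one-letter words. -/
def letterVal : List (ℤ × A) → A
  | [x] => x.2
  | _ => 0

lemma letterVal_of_two_le {w : List (ℤ × A)} (h : 2 ≤ w.length) : letterVal w = 0 := by
  match w, h with
  | _ :: _ :: _, _ => rfl

lemma insertOp_letterVal (m : List (ℤ × A) → A) {w : List (ℤ × A)} (h : 2 ≤ w.length) :
    insertOp m letterVal w = m w := by
  have h1 : ∀ (x : ℤ × A) (u t : List (ℤ × A)), splitSum (fun x' y =>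
      (if 2 ≤ x'.length then (1 : ℤ) else 0) • wordSign (x :: u) •
        letterVal (x :: u ++ opLetter m x' :: y)) t = 0 := fun x u t => by
    refine (splitSum_congr (G := fun _ _ => 0) fun a b _ => ?_).trans Finset.sum_const_zero
    rw [letterVal_of_two_le (by simp; omega), smul_zero, smul_zero]
  have h2 : ∀ z : List (ℤ × A), splitSum (fun x y =>
      (if 2 ≤ x.length then (1 : ℤ) else 0) • wordSign ([] : List (ℤ × A)) •
        letterVal ([] ++ opLetter m x :: y)) z = if 2 ≤ z.length then m z else 0 := fun z => by
    rw [splitSum, Finset.sum_range_succ, Finset.sum_eq_zero]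
    · simp [wordSign, wordDeg, letterVal, opLetter]
    · intro i hi
      have hi := Finset.mem_range.1 hi
      rw [letterVal_of_two_le (by simp; omega), smul_zero, smul_zero]
  obtain ⟨x, u, rfl⟩ : ∃ x u, w = x :: u := by
    match w, h with
    | x :: u, _ => exact ⟨x, u, rfl⟩
  rw [insertOp, splitSum_cons, h2, if_pos h,
    splitSum_congr (G := fun _ _ => 0) (fun a b _ => h1 x a b)]
  exact (congrArg _ Finset.sum_const_zero).trans (add_zero _)

lemma insertOp_of_length_lt_two (m f : List (ℤ × A) → A) {w : List (ℤ × A)} (h : w.length < 2) :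
    insertOp m f w = 0 := by
  refine (splitSum_congr (G := fun _ _ => 0) fun u t hut => ?_).trans Finset.sum_const_zero
  refine (splitSum_congr (G := fun _ _ => 0) fun x y hxy => ?_).trans Finset.sum_const_zero
  subst hxy hut
  rw [if_neg, zero_smul]
  simp at h
  omega

end Words

/-! ### Merkulov's maps -/

/-- A product of multilinear maps in consecutive blocks of variables is multilinear. -/
lemma exists_multilinearMap_mul {𝕜 A : Type*} [CommRing 𝕜] [NonUnitalRing A] [Module 𝕜 A]
    [IsScalarTower 𝕜 A A] [SMulCommClass 𝕜 A A] {n k l : ℕ} (h : k + l = n)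
    (S : MultilinearMap 𝕜 (fun _ : Fin k => A) A) (T : MultilinearMap 𝕜 (fun _ : Fin l => A) A) :
    ∃ U : MultilinearMap 𝕜 (fun _ : Fin n => A) A, ∀ v : ℕ → A,
      S (fun i => v i) * T (fun i => v (k + i)) = U (fun i => v i) := by
  subst h
  refine ⟨((LinearMap.mul' 𝕜 A).compMultilinearMap (S.domCoprod T)).domDomCongr finSumFinEquiv,
    fun v => ?_⟩
  simp

namespace HodgeDGA

variable {𝕜 A : Type*} [RCLike 𝕜] [NonUnitalRing A] [Module 𝕜 A]
  [IsScalarTower 𝕜 A A] [SMulCommClass 𝕜 A A]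
  {𝒜 : ℤ → Submodule 𝕜 A} [DirectSum.Decomposition 𝒜] [SetLike.GradedMul 𝒜]
  (D : HodgeDGA 𝕜 𝒜)

/-- The maps `Q λₙ`, with the convention `Q λ₁ = -id` that makes the recursion for `λₙ` uniform. -/
noncomputable def qlam (n : ℕ) (p : ℕ → ℤ) (v : ℕ → A) : A :=
  D.Q (D.lam n p v) - if n = 1 then v 0 else 0

lemma lam_zero (p : ℕ → ℤ) (v : ℕ → A) : D.lam 0 p v = 0 := by
  rw [lam]

lemma lam_one (p : ℕ → ℤ) (v : ℕ → A) : D.lam 1 p v = 0 := by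
  rw [lam]

lemma qlam_zero (p : ℕ → ℤ) (v : ℕ → A) : D.qlam 0 p v = 0 := by
  simp [qlam, lam_zero]

lemma qlam_one (p : ℕ → ℤ) (v : ℕ → A) : D.qlam 1 p v = -v 0 := by
  simp [qlam, lam_one]

lemma qlam_add_two (n : ℕ) (p : ℕ → ℤ) (v : ℕ → A) :
    D.qlam (n + 2) p v = D.Q (D.lam (n + 2) p v) := by
  simp [qlam]

/-- The `k`-th term of the uniform recursion for `λₙ`. -/
noncomputable def lamTerm (n k : ℕ) (p : ℕ → ℤ) (v : ℕ → A) : A :=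
  ((k : ℤ) + 1 + ((n : ℤ) - k - 1) * ∑ s ∈ Finset.range k, p s).negOnePow •
    (D.qlam k p v * D.qlam (n - k) (fun i => p (k + i)) (fun i => v (k + i)))

lemma lamTerm_zero (n : ℕ) (p : ℕ → ℤ) (v : ℕ → A) : D.lamTerm n 0 p v = 0 := by
  simp [lamTerm, qlam_zero]

lemma lamTerm_self (n : ℕ) (p : ℕ → ℤ) (v : ℕ → A) : D.lamTerm n n p v = 0 := by
  simp [lamTerm, qlam_zero]

/-- Merkulov's recursion in uniform shape. -/
lemma lam_eq (n : ℕ) (p : ℕ → ℤ) (v : ℕ → A) :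
    D.lam n p v = ∑ k ∈ Finset.range (n + 1), D.lamTerm n k p v := by
  match n with
  | 0 => simp [lam_zero, lamTerm_zero]
  | 1 => simp [lam_one, Finset.sum_range_succ, lamTerm_zero, lamTerm_self]
  | 2 =>
    simp [Finset.sum_range_succ, lamTerm_zero, lamTerm_self]
    simp [lamTerm, qlam_one, lam]
    rw [Int.negOnePow_even 2 ⟨1, rfl⟩, one_smul]
  | n + 3 =>
    rw [Finset.sum_range_succ, lamTerm_self, add_zero, Finset.sum_range_succ', lamTerm_zero,
      add_zero, Finset.sum_range_succ, Finset.sum_range_succ', lam,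
      Fin.sum_univ_eq_sum_range (fun i => (((i : ℤ) + 2) + ((n : ℤ) - i) *
        ∑ s ∈ Finset.range (i + 2), p s).negOnePow • (D.Q (D.lam (i + 2) p v) *
          D.Q (D.lam (n + 1 - i) (fun s => p (i + 2 + s)) (fun s => v (i + 2 + s))))) n,
      sub_eq_add_neg, sub_eq_add_neg, ← Finset.sum_neg_distrib, add_right_comm,
      add_comm (_ • _) (Finset.sum _ _), add_assoc, add_assoc,
      add_comm (_ • (D.Q (D.lam (n + 2) p v) * v (n + 2)))]
    congr 1
    -- the terms with two factors `Q λ`, then those with a factor `Q λ₁ = -id` on the left or right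
    · refine Finset.sum_congr rfl fun i hi => ?_
      have hi := Finset.mem_range.1 hi
      obtain ⟨r, rfl⟩ : ∃ r, n = i + 1 + r := ⟨n - (i + 1), by omega⟩
      rw [lamTerm, show i + 1 + r + 3 - (i + 1 + 1) = r + 2 by omega,
        show i + 1 + r + 1 - i = r + 2 by omega, qlam_add_two, qlam_add_two, ← Units.neg_smul,
        ← Int.negOnePow_succ]
      congr 2
      push_cast
      ring
    · congr 1
      · rw [lamTerm, show n + 3 - (0 + 1) = n + 2 by omega, qlam_add_two, zero_add, qlam_one,
          ← Units.neg_smul, ← Int.negOnePow_succ, neg_mul, smul_neg, ← Units.neg_smul,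
          ← Int.negOnePow_succ]
        congr 1
        rw [Int.negOnePow_eq_iff]
        simp only [Finset.sum_range_one]
        push_cast
        exact ⟨p 0 - 1, by ring⟩
      · rw [lamTerm, show n + 3 - (n + 1 + 1) = 1 by omega, qlam_one, qlam_add_two, mul_neg,
          smul_neg, ← Units.neg_smul, ← Int.negOnePow_succ]
        congr 1
        rw [Int.negOnePow_eq_iff]
        push_cast
        exact ⟨-1, by ring⟩

/-- The recursion without its two vanishing end terms; the remaining ones involve only `λ_k` with
`k < n`. -/
lemma lam_eq' (n : ℕ) (p : ℕ → ℤ) (v : ℕ → A) :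
    D.lam n p v = ∑ k ∈ Finset.Ioo 0 n, D.lamTerm n k p v := by
  rw [lam_eq]
  refine (Finset.sum_subset (fun k hk => ?_) fun k hk hk' => ?_).symm
  · simp at hk ⊢
    omega
  · simp at hk hk'
    obtain rfl | h := Nat.eq_zero_or_pos k
    · exact D.lamTerm_zero n p v
    · obtain rfl : k = n := by omega
      exact D.lamTerm_self k p v

lemma lam_congr {n : ℕ} {p p' : ℕ → ℤ} {v v' : ℕ → A} (hp : ∀ i < n, p i = p' i)
    (hv : ∀ i < n, v i = v' i) : D.lam n p v = D.lam n p' v' := by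
  induction n using Nat.strong_induction_on generalizing p p' v v' with
  | _ n ih =>
    rw [lam_eq', lam_eq']
    refine Finset.sum_congr rfl fun k hk => ?_
    have hk := Finset.mem_Ioo.1 hk
    rw [lamTerm, lamTerm, qlam, qlam, qlam, qlam, hv 0 (by omega),
      ih k hk.2 (fun i hi => hp i (by omega)) (fun i hi => hv i (by omega)),
      ih (n - k) (by omega) (fun i hi => hp (k + i) (by omega)) (fun i hi => hv (k + i) (by omega)),
      hv (k + 0) (by omega),
      Finset.sum_congr rfl fun i hi => hp i ((Finset.mem_range.1 hi).trans hk.2)]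

lemma qlam_congr {n : ℕ} {p p' : ℕ → ℤ} {v v' : ℕ → A} (hp : ∀ i < n, p i = p' i)
    (hv : ∀ i < n, v i = v' i) : D.qlam n p v = D.qlam n p' v' := by
  rw [qlam, qlam, D.lam_congr hp hv]
  split_ifs with h
  · rw [hv 0 (by omega)]
  · rfl

lemma qlam_mem_of_lam_mem {n : ℕ} {p : ℕ → ℤ} {v : ℕ → A} (hv : ∀ i < n, v i ∈ 𝒜 (p i))
    (h : D.lam n p v ∈ 𝒜 (∑ i ∈ Finset.range n, p i + 2 - n)) :
    D.qlam n p v ∈ 𝒜 (∑ i ∈ Finset.range n, p i + 1 - n) := by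
  refine sub_mem ?_ ?_
  · convert D.Q_mem h using 2
    ring
  · split_ifs with h1
    · subst h1
      simpa using hv 0 one_pos
    · exact zero_mem _

/-- `λₙ` has degree `2 - n`. -/
lemma lam_mem {n : ℕ} {p : ℕ → ℤ} {v : ℕ → A} (hv : ∀ i < n, v i ∈ 𝒜 (p i)) :
    D.lam n p v ∈ 𝒜 (∑ i ∈ Finset.range n, p i + 2 - n) := by
  induction n using Nat.strong_induction_on generalizing p v with
  | _ n ih =>
    rw [lam_eq']
    refine sum_mem fun k hk => ?_
    have hk := Finset.mem_Ioo.1 hk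
    have h1 : ∀ i < k, v i ∈ 𝒜 (p i) := fun i hi => hv i (by omega)
    have h2 : ∀ i < n - k, v (k + i) ∈ 𝒜 (p (k + i)) := fun i hi => hv (k + i) (by omega)
    refine (𝒜 _).smul_of_tower_mem _ ?_
    convert SetLike.GradedMul.mul_mem (D.qlam_mem_of_lam_mem h1 (ih k hk.2 h1))
      (D.qlam_mem_of_lam_mem h2 (ih (n - k) (by omega) h2)) using 2
    obtain ⟨r, rfl⟩ : ∃ r, n = k + r := ⟨n - k, by omega⟩
    rw [Finset.sum_range_add, Nat.add_sub_cancel_left]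
    push_cast
    ring

/-- For fixed degrees, `λₙ` is multilinear. -/
lemma exists_multilinearMap_lam (n : ℕ) (p : ℕ → ℤ) :
    ∃ T : MultilinearMap 𝕜 (fun _ : Fin n => A) A, ∀ v : ℕ → A, D.lam n p v = T (fun i => v i) := by
  induction n using Nat.strong_induction_on generalizing p with
  | _ n ih =>
    have hq : ∀ k < n, ∀ p : ℕ → ℤ, ∃ T : MultilinearMap 𝕜 (fun _ : Fin k => A) A,
        ∀ v : ℕ → A, D.qlam k p v = T (fun i => v i) := fun k hk p => by
      obtain ⟨T, hT⟩ := ih k hk p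
      by_cases h : k = 1
      · subst h
        exact ⟨-(MultilinearMap.ofSubsingleton 𝕜 A A 0 LinearMap.id), fun v => by simp [qlam_one]⟩
      · exact ⟨D.Q.compMultilinearMap T, fun v => by simp [qlam, h, hT]⟩
    have ht : ∀ k ∈ Finset.Ioo 0 n, ∃ T : MultilinearMap 𝕜 (fun _ : Fin n => A) A,
        ∀ v : ℕ → A, D.lamTerm n k p v = T (fun i => v i) := fun k hk => by
      have hk := Finset.mem_Ioo.1 hk
      obtain ⟨S, hS⟩ := hq k hk.2 p
      obtain ⟨T, hT⟩ := hq (n - k) (by omega) (fun i => p (k + i))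
      obtain ⟨U, hU⟩ := exists_multilinearMap_mul (n := n) (by omega) S T
      refine ⟨((((k : ℤ) + 1 + ((n : ℤ) - k - 1) * ∑ s ∈ Finset.range k, p s).negOnePow : ℤˣ) : ℤ)
        • U, fun v => ?_⟩
      rw [lamTerm, hS, hT, hU]
      rfl
    choose! T hT using ht
    refine ⟨∑ k ∈ Finset.Ioo 0 n, T k, fun v => ?_⟩
    rw [lam_eq', sum_apply]
    exact Finset.sum_congr rfl fun k hk => hT k hk v

end HodgeDGA

/-! ### The maps `λₙ` as functions on words -/

namespace HodgeDGA

variable {𝕜 A : Type*} [RCLike 𝕜] [NonUnitalRing A] [Module 𝕜 A]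
  [IsScalarTower 𝕜 A A] [SMulCommClass 𝕜 A A]
  {𝒜 : ℤ → Submodule 𝕜 A} [DirectSum.Decomposition 𝒜] [SetLike.GradedMul 𝒜]
  (D : HodgeDGA 𝕜 𝒜)

/-- The degree of the letter of `w` at position `i`. -/
def degAt (w : List (ℤ × A)) (i : ℕ) : ℤ := (w.getD i 0).1

/-- The value of the letter of `w` at position `i`. -/
def valAt (w : List (ℤ × A)) (i : ℕ) : A := (w.getD i 0).2

lemma getD_append_add (u v : List (ℤ × A)) (i : ℕ) :
    (u ++ v).getD (u.length + i) 0 = v.getD i 0 := by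
  rw [List.getD_append_right _ _ _ _ (Nat.le_add_right _ _), Nat.add_sub_cancel_left]

lemma sum_degAt (w : List (ℤ × A)) : ∑ i ∈ Finset.range w.length, degAt w i = wordDeg w := by
  induction w with
  | nil => rfl
  | cons x w ih =>
    rw [List.length_cons, Finset.sum_range_succ', wordDeg_cons, ← ih, add_comm]
    rfl

/-- `λ` on words, with the sign of the desuspension. -/
noncomputable def wlam (w : List (ℤ × A)) : A :=
  (suspExp w).negOnePow • D.lam w.length (degAt w) (valAt w)

/-- `Q λ - id` on words, with the sign of the desuspension; the identity is supported on the words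
of length `1`. -/
noncomputable def wq (w : List (ℤ × A)) : A := D.Q (D.wlam w) - letterVal w

lemma wlam_of_length_lt_two {w : List (ℤ × A)} (h : w.length < 2) : D.wlam w = 0 := by
  match w, h with
  | [], _ => simp [wlam, lam_zero]
  | [_], _ => simp [wlam, lam_one]

lemma wq_eq (w : List (ℤ × A)) :
    D.wq w = (suspExp w).negOnePow • D.qlam w.length (degAt w) (valAt w) := by
  have hQ : D.Q (D.wlam w) = (suspExp w).negOnePow • D.Q (D.lam w.length (degAt w) (valAt w)) :=
    map_zsmul_unit D.Q _ _
  rw [wq, qlam, smul_sub, hQ]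
  congr 1
  match w with
  | [] => simp [letterVal]
  | [x] =>
    simp [letterVal, suspExp, valAt]
    rw [Int.negOnePow_even 2 ⟨1, rfl⟩, one_smul]
  | x :: y :: w => simp [letterVal]

/-- In terms of words Merkulov's recursion is `λ = q * q`. -/
lemma wlam_eq_convSq (w : List (ℤ × A)) : D.wlam w = convSq D.wq w := by
  rw [wlam, lam_eq, Finset.smul_sum, convSq, splitSum]
  refine Finset.sum_congr rfl fun k hk => ?_
  have hk : k ≤ w.length := Nat.lt_succ_iff.1 (Finset.mem_range.1 hk)
  obtain ⟨u, v, rfl, rfl⟩ : ∃ u v, w = u ++ v ∧ k = u.length :=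
    ⟨w.take k, w.drop k, (List.take_append_drop k w).symm, by simp [hk]⟩
  have h1 : ∀ i < u.length, (u ++ v).getD i 0 = u.getD i 0 := fun i hi =>
    List.getD_append _ _ _ _ hi
  have h2 := getD_append_add u v
  have e1 : D.qlam u.length (degAt (u ++ v)) (valAt (u ++ v)) =
      D.qlam u.length (degAt u) (valAt u) :=
    D.qlam_congr (fun i hi => congrArg Prod.fst (h1 i hi)) fun i hi => congrArg Prod.snd (h1 i hi)
  have e2 : D.qlam v.length (fun i => degAt (u ++ v) (u.length + i))
      (fun i => valAt (u ++ v) (u.length + i)) = D.qlam v.length (degAt v) (valAt v) :=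
    D.qlam_congr (fun i _ => congrArg Prod.fst (h2 i)) fun i _ => congrArg Prod.snd (h2 i)
  have e3 : ∑ s ∈ Finset.range u.length, degAt (u ++ v) s = wordDeg u := by
    rw [← sum_degAt]
    exact Finset.sum_congr rfl fun i hi => congrArg Prod.fst (h1 i (Finset.mem_range.1 hi))
  rw [List.take_left, List.drop_left, lamTerm, wq_eq, wq_eq, e1, e3,
    show (u ++ v).length - u.length = v.length by simp, e2, smul_mul_assoc, mul_smul_comm,
    smul_smul, smul_smul, smul_smul, wordSign, ← Int.negOnePow_add, ← Int.negOnePow_add,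
    ← Int.negOnePow_add]
  congr 1
  rw [Int.negOnePow_eq_iff, suspExp_append, List.length_append]
  push_cast
  exact ⟨(v.length - 1) * wordDeg u, by ring⟩

/-- A word whose letters are closed and homogeneous of the indicated degrees. -/
def IsClosedWord (w : List (ℤ × A)) : Prop := ∀ x ∈ w, x.2 ∈ 𝒜 x.1 ∧ D.d x.2 = 0

variable {D}

lemma IsClosedWord.left {u v : List (ℤ × A)} (h : D.IsClosedWord (u ++ v)) : D.IsClosedWord u :=
  fun x hx => h x (List.mem_append_left _ hx)

lemma IsClosedWord.right {u v : List (ℤ × A)} (h : D.IsClosedWord (u ++ v)) : D.IsClosedWord v :=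
  fun x hx => h x (List.mem_append_right _ hx)

lemma IsClosedWord.valAt_mem {w : List (ℤ × A)} (h : D.IsClosedWord w) (i : ℕ) :
    valAt w i ∈ 𝒜 (degAt w i) := by
  rw [valAt, degAt]
  by_cases hi : i < w.length
  · rw [List.getD_eq_getElem _ _ hi]
    exact (h _ (List.getElem_mem hi)).1
  · rw [List.getD_eq_default _ _ (by omega)]
    exact zero_mem _

lemma IsClosedWord.wq_mem {w : List (ℤ × A)} (h : D.IsClosedWord w) :
    D.wq w ∈ 𝒜 (wordDeg w + 1 - w.length) := by
  rw [wq_eq, ← sum_degAt]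
  exact (𝒜 _).smul_of_tower_mem _
    (D.qlam_mem_of_lam_mem (fun i _ => h.valAt_mem i) (D.lam_mem fun i _ => h.valAt_mem i))

lemma IsClosedWord.d_letterVal {w : List (ℤ × A)} (h : D.IsClosedWord w) :
    D.d (letterVal w) = 0 := by
  match w, h with
  | [], _ => simp [letterVal]
  | [x], h => exact (h x (by simp)).2
  | _ :: _ :: _, _ => simp [letterVal]

variable (D)

/-- The operations `m = (1 - [d, Q]) λ` on words, with the sign of the desuspension. -/
noncomputable def wm (w : List (ℤ × A)) : A := D.harmonicProj (D.wlam w)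

variable {D}

/-- If `d λ = -λ ∘ m̂`, where `m̂` is the coderivation induced by `m`, then `d q = λ + q ∘ m̂`. -/
lemma IsClosedWord.d_wq {w : List (ℤ × A)} (h : D.IsClosedWord w)
    (hd : D.d (D.wlam w) = -insertOp D.wm D.wlam w) :
    D.d (D.wq w) = D.wlam w + insertOp D.wm D.wq w := by
  have h1 : insertOp D.wm D.wq w = D.Q (insertOp D.wm D.wlam w) - insertOp D.wm letterVal w := by
    have h2 := map_insertOp D.wm D.wlam D.Q.toAddMonoidHom w
    simp only [LinearMap.toAddMonoidHom_coe] at h2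
    rw [h2, ← insertOp_sub]
    rfl
  rw [wq, map_sub, h.d_letterVal, sub_zero]
  by_cases hw : 2 ≤ w.length
  · rw [d_Q, hd, h1, insertOp_letterVal _ hw, wm, map_neg]
    abel
  · rw [D.wlam_of_length_lt_two (by omega), insertOp_of_length_lt_two _ _ (by omega)]
    simp

/-- The key identity: on words of closed elements, `d λ = -λ ∘ m̂`. The Leibniz rules for `d` and
`m̂` reduce it to shorter words, up to the terms `(q * q) * q - q * (q * q)`, which cancel. -/
theorem IsClosedWord.d_wlam {w : List (ℤ × A)} (h : D.IsClosedWord w) :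
    D.d (D.wlam w) = -insertOp D.wm D.wlam w := by
  induction hn : w.length using Nat.strong_induction_on generalizing w with
  | _ n ih =>
    subst hn
    have hq : ∀ u : List (ℤ × A), D.IsClosedWord u → u.length < w.length →
        D.d (D.wq u) = D.wlam u + insertOp D.wm D.wq u := fun u hu hlt =>
      hu.d_wq (ih _ hlt hu rfl)
    have hnil : D.wq [] = 0 := by
      rw [wq, D.wlam_of_length_lt_two (by simp), map_zero]
      exact sub_zero _
    have hnil' : insertOp D.wm D.wq [] = 0 := insertOp_of_length_lt_two _ _ (by simp)
    have hnil'' : D.wlam [] = 0 := D.wlam_of_length_lt_two (by simp)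
    have key : ∀ u v : List (ℤ × A), u ++ v = w → D.d (wordSign u • (D.wq u * D.wq v)) =
        (wordSign u • (D.wlam u * D.wq v) - D.wq u * D.wlam v) -
          (D.wq u * insertOp D.wm D.wq v - wordSign u • (insertOp D.wm D.wq u * D.wq v)) := by
      rintro u v rfl
      have hs : D.d (wordSign u • (D.wq u * D.wq v)) = wordSign u • D.d (D.wq u * D.wq v) :=
        map_zsmul_unit D.d _ _
      -- at the two ends of the word one factor is `q` of the empty word, which is `0`
      rcases u.eq_nil_or_concat with rfl | ⟨u', x, hu⟩
      · simp [hnil, hnil', hnil'']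
      rcases v.eq_nil_or_concat with rfl | ⟨v', y, hv⟩
      · simp [hnil, hnil', hnil'']
      have hsign : (wordDeg u + 1 - u.length).negOnePow = -wordSign u := by
        rw [wordSign, ← Int.negOnePow_succ, Int.negOnePow_eq_iff]
        exact ⟨-u.length, by ring⟩
      rw [hs, D.leibniz _ _ _ h.left.wq_mem, hq u h.left (by simp [hv]),
        hq v h.right (by simp [hu]; omega), hsign, Units.neg_smul, add_mul, mul_add, smul_add,
        smul_neg, smul_smul, wordSign_mul_self, one_smul, smul_add]
      abel
    have h1 : D.d (D.wlam w) = splitSum (fun u v => D.d (wordSign u • (D.wq u * D.wq v))) w := by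
      rw [wlam_eq_convSq]
      exact map_splitSum D.d.toAddMonoidHom _ _
    have h2 : D.wlam = convSq D.wq := funext D.wlam_eq_convSq
    rw [h1, splitSum_congr key, splitSum_sub, splitSum_sub, splitSum_sub, h2, convSq_assoc,
      sub_self, zero_sub, insertOp_convSq]

/-- The `A∞` relation on words: apply the harmonic projection, which kills exact elements, to
`d λ = -λ ∘ m̂`. -/
theorem IsClosedWord.insertOp_wm {w : List (ℤ × A)} (h : D.IsClosedWord w) :
    insertOp D.wm D.wm w = 0 := by
  have h1 := map_insertOp D.wm D.wlam
    (D.harmonic.subtype ∘ₗ D.harmonicProj).toAddMonoidHom w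
  refine h1.symm.trans ?_
  rw [← neg_neg (insertOp _ _ _), ← h.d_wlam, ← map_neg]
  simp [harmonicProj_d]

end HodgeDGA

/-! ### Multilinear maps on a graded space -/

section GradedMultilinear

variable {𝕜 V W : Type*} [Field 𝕜] [AddCommGroup V] [Module 𝕜 V] [AddCommGroup W] [Module 𝕜 W]
  {𝒱 : ℤ → Submodule 𝕜 V}

/-- A family of multilinear maps, one for each choice of degrees of the arguments, is induced by a
multilinear map on the whole graded space. -/
lemma DirectSum.IsInternal.exists_multilinearMap (h : DirectSum.IsInternal 𝒱) {k : ℕ}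
    (f : (Fin k → ℤ) → MultilinearMap 𝕜 (fun _ : Fin k => V) W) :
    ∃ m : MultilinearMap 𝕜 (fun _ : Fin k => V) W, ∀ (p : Fin k → ℤ) (v : Fin k → V),
      (∀ i, v i ∈ 𝒱 (p i)) → m v = f p v := by
  let := h.chooseDecomposition
  refine ⟨(MultilinearMap.fromDirectSumEquiv fun p : Fin k → ℤ =>
    (f p).compLinearMap fun i => (𝒱 (p i)).subtype).compLinearMap
      fun _ => (DirectSum.decomposeLinearEquiv 𝒱).toLinearMap, fun p v hv => ?_⟩
  have h1 : (fun i => DirectSum.decomposeLinearEquiv (R := 𝕜) 𝒱 (v i)) =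
      fun i => DirectSum.lof 𝕜 ℤ (fun j => 𝒱 j) (p i) ⟨v i, hv i⟩ :=
    funext fun i => DirectSum.decompose_of_mem 𝒱 (hv i)
  rw [MultilinearMap.compLinearMap_apply]
  simp only [LinearEquiv.coe_coe]
  rw [h1, MultilinearMap.fromDirectSumEquiv_lof]
  rfl

lemma DirectSum.IsInternal.multilinearMap_ext (h : DirectSum.IsInternal 𝒱) {k : ℕ}
    {f g : MultilinearMap 𝕜 (fun _ : Fin k => V) W}
    (hfg : ∀ (p : Fin k → ℤ) (v : Fin k → V), (∀ i, v i ∈ 𝒱 (p i)) → f v = g v) : f = g := by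
  let := h.chooseDecomposition
  set e := DirectSum.decomposeLinearEquiv (R := 𝕜) 𝒱
  have h1 : f.compLinearMap (fun _ => e.symm.toLinearMap) =
      g.compLinearMap (fun _ => e.symm.toLinearMap) := by
    refine MultilinearMap.directSum_ext fun p => MultilinearMap.ext fun v => ?_
    refine hfg p _ fun i => ?_
    change (DirectSum.decompose 𝒱).symm (DirectSum.of (fun j => 𝒱 j) (p i) (v i)) ∈ _
    rw [DirectSum.decompose_symm_of]
    exact (v i).2
  ext v
  simpa using congrArg (fun m => m fun i => e (v i)) h1

end GradedMultilinear

/-! ### The `A∞` structure on the harmonic elements -/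

lemma AInfinityStructure.ext_m {𝕜 V : Type*} [Field 𝕜] [AddCommGroup V] [Module 𝕜 V]
    {𝒱 : ℤ → Submodule 𝕜 V} {M N : AInfinityStructure 𝒱} (h : ∀ k, M.m k = N.m k) : M = N := by
  cases M
  cases N
  congr
  exact funext h

namespace HodgeDGA

variable {𝕜 A : Type*} [RCLike 𝕜] [NonUnitalRing A] [Module 𝕜 A]
  [IsScalarTower 𝕜 A A] [SMulCommClass 𝕜 A A]
  {𝒜 : ℤ → Submodule 𝕜 A} [DirectSum.Decomposition 𝒜] [SetLike.GradedMul 𝒜]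
  (D : HodgeDGA 𝕜 𝒜)

lemma exists_operation (k : ℕ) :
    ∃ m : MultilinearMap 𝕜 (fun _ : Fin k => D.harmonic) D.harmonic,
      ∀ (p : ℕ → ℤ) (a : ℕ → D.harmonic), (∀ i < k, a i ∈ D.harmonicGrading (p i)) →
        m (fun i => a i) = D.harmonicProj (D.lam k p fun i => a i) := by
  choose T hT using D.exists_multilinearMap_lam k
  obtain ⟨m, hm⟩ := D.isInternal_harmonicGrading.exists_multilinearMap
    (fun p : Fin k → ℤ => (D.harmonicProj.compMultilinearMap
      (T fun i => if h : i < k then p ⟨i, h⟩ else 0)).compLinearMap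
        fun _ => D.harmonic.subtype)
  refine ⟨m, fun p a ha => ?_⟩
  rw [hm (fun i => p i) _ fun i => ha i i.2]
  have h1 := hT (fun i => if i < k then p i else 0) (fun i => (a i : A))
  rw [D.lam_congr (p' := p) (v' := fun i => (a i : A)) (fun i hi => if_pos hi) fun _ _ => rfl] at h1
  rw [h1]
  simp

/-- The operations `(1 - [d, Q]) λₖ` as multilinear maps on the harmonic elements. -/
noncomputable def operation (k : ℕ) : MultilinearMap 𝕜 (fun _ : Fin k => D.harmonic) D.harmonic :=
  (D.exists_operation k).choose

lemma operation_apply {k : ℕ} {p : ℕ → ℤ} {a : ℕ → D.harmonic}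
    (ha : ∀ i < k, a i ∈ D.harmonicGrading (p i)) :
    D.operation k (fun i => a i) = D.harmonicProj (D.lam k p fun i => a i) :=
  (D.exists_operation k).choose_spec p a ha

/-- Finite families of homogeneous elements extend to sequences. -/
lemma exists_extend {k : ℕ} {p : Fin k → ℤ} {v : Fin k → D.harmonic}
    (hv : ∀ i, v i ∈ D.harmonicGrading (p i)) :
    ∃ (q : ℕ → ℤ) (a : ℕ → D.harmonic), (∀ i < k, a i ∈ D.harmonicGrading (q i)) ∧
      (∀ i : Fin k, q i = p i) ∧ v = fun i : Fin k => a i := by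
  refine ⟨fun i => if h : i < k then p ⟨i, h⟩ else 0, fun i => if h : i < k then v ⟨i, h⟩ else 0,
    fun i hi => ?_, fun i => by simp, by simp⟩
  simp only [dif_pos hi]
  exact hv _

lemma operation_eq_zero {k : ℕ} (hk : k < 2) : D.operation k = 0 := by
  refine D.isInternal_harmonicGrading.multilinearMap_ext fun p v hv => ?_
  obtain ⟨q, a, ha, -, rfl⟩ := D.exists_extend hv
  rw [D.operation_apply ha]
  interval_cases k
  · simp [lam_zero]
  · simp [lam_one]

lemma operation_mem {k : ℕ} {p : ℕ → ℤ} {a : ℕ → D.harmonic}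
    (ha : ∀ i < k, a i ∈ D.harmonicGrading (p i)) :
    D.operation k (fun i => a i) ∈ D.harmonicGrading (∑ i ∈ Finset.range k, p i + 2 - k) := by
  rw [D.operation_apply ha]
  exact D.harmonicProj_mem (D.lam_mem fun i hi => ha i hi)

/-- The operations evaluated on a word of harmonic elements. -/
lemma coe_operation_eq_wm {k : ℕ} {a : ℕ → D.harmonic} {w : List (ℤ × A)} (hw : w.length = k)
    (hv : ∀ i < k, valAt w i = a i) (hd : ∀ i < k, (a i : A) ∈ 𝒜 (degAt w i)) :
    (D.operation k (fun i => a i) : A) = (suspExp w).negOnePow • D.wm w := by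
  subst hw
  have h1 : (D.wm w : A) = (suspExp w).negOnePow •
      (D.harmonicProj (D.lam w.length (degAt w) (valAt w)) : A) :=
    map_zsmul_unit (D.harmonic.subtype ∘ₗ D.harmonicProj) _ _
  rw [h1, smul_smul, Int.units_mul_self, one_smul, D.operation_apply (p := degAt w) hd,
    D.lam_congr (fun _ _ => rfl) hv]

lemma getD_seqWord (p : ℕ → ℤ) (v : ℕ → A) {n i : ℕ} (hi : i < n) :
    (seqWord p v n).getD i 0 = (p i, v i) := by
  simp [seqWord, hi]

lemma wordDeg_seqWord (p : ℕ → ℤ) (v : ℕ → A) (n : ℕ) :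
    wordDeg (seqWord p v n) = ∑ i ∈ Finset.range n, p i := by
  rw [← sum_degAt, length_seqWord]
  refine Finset.sum_congr rfl fun i hi => ?_
  rw [degAt, getD_seqWord _ _ (Finset.mem_range.1 hi)]

/-- The letters of a word in which a block of letters is replaced by a single one. -/
lemma getD_replace (p : ℕ → ℤ) (v : ℕ → A) (c : ℤ × A) (j l r i : ℕ) (hl : 1 ≤ l)
    (hi : i < j + 1 + r) :
    (seqWord p v j ++ c :: seqWord (fun s => p (j + (l + s))) (fun s => v (j + (l + s))) r).getD i 0
      = if i < j then (p i, v i) else if i = j then c else (p (i + l - 1), v (i + l - 1)) := by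
  split_ifs with h1 h2
  · rw [List.getD_append _ _ _ _ (by rwa [length_seqWord]), getD_seqWord _ _ h1]
  · subst h2
    rw [List.getD_append_right _ _ _ _ (by rw [length_seqWord]), length_seqWord, Nat.sub_self]
    rfl
  · obtain ⟨s, rfl⟩ : ∃ s, i = j + (s + 1) := ⟨i - j - 1, by omega⟩
    rw [List.getD_append_right _ _ _ _ (by rw [length_seqWord]; omega), length_seqWord,
      Nat.add_sub_cancel_left, List.getD_cons_succ, getD_seqWord _ _ (by omega),
      show j + (s + 1) + l - 1 = j + (l + s) by omega]

/-- The term of the `A∞` relation that inserts the operation in `l` arguments at position `j`. -/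
noncomputable def relTerm (n : ℕ) (p : ℕ → ℤ) (v : ℕ → D.harmonic) (l j : ℕ) : D.harmonic :=
  ((j : ℤ) + l * ((n : ℤ) - j - l) + l * ∑ i ∈ Finset.range j, p i).negOnePow •
    D.operation (n + 1 - l) (fun i : Fin (n + 1 - l) =>
      if (i : ℕ) < j then v i
      else if (i : ℕ) = j then D.operation l (fun s : Fin l => v (j + s))
      else v (i + l - 1))

lemma relTerm_one (n : ℕ) (p : ℕ → ℤ) (v : ℕ → D.harmonic) {j : ℕ} (hj : j < n) :
    D.relTerm n p v 1 j = 0 := by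
  rw [relTerm, MultilinearMap.map_coord_zero _ (⟨j, by omega⟩ : Fin (n + 1 - 1)), smul_zero]
  simp [D.operation_eq_zero one_lt_two]

/-- Up to the sign of the desuspension of the whole word, the terms of the `A∞` relation are those
of the coderivation on words. -/
lemma coe_relTerm {p : ℕ → ℤ} {v : ℕ → D.harmonic} {j l r : ℕ} (hl : 2 ≤ l)
    (hv : ∀ i < j + (l + r), v i ∈ D.harmonicGrading (p i)) :
    (D.relTerm (j + (l + r)) p v l j : A) =
      (suspExp (seqWord p (fun i => (v i : A)) (j + (l + r)))).negOnePow •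
      wordSign (seqWord p (fun i => (v i : A)) j) •
        D.wm (seqWord p (fun i => (v i : A)) j ++
          opLetter D.wm (seqWord (fun i => p (j + i)) (fun i => (v (j + i) : A)) l) ::
          seqWord (fun i => p (j + (l + i))) (fun i => (v (j + (l + i)) : A)) r) := by
  set u := seqWord p (fun i => (v i : A)) j with hu
  set x := seqWord (fun i => p (j + i)) (fun i => (v (j + i) : A)) l with hx
  set y := seqWord (fun i => p (j + (l + i))) (fun i => (v (j + (l + i)) : A)) r with hy
  have hvx : ∀ i < l, v (j + i) ∈ D.harmonicGrading (p (j + i)) := fun i hi => hv _ (by omega)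
  have lu : u.length = j := length_seqWord _ _ _
  have lx : x.length = l := length_seqWord _ _ _
  have ly : y.length = r := length_seqWord _ _ _
  have hw : seqWord p (fun i => (v i : A)) (j + (l + r)) = u ++ (x ++ y) := by
    rw [seqWord_add, seqWord_add]
  have gx : ∀ i < l, x.getD i 0 = (p (j + i), (v (j + i) : A)) := fun i hi =>
    getD_seqWord (fun i => p (j + i)) (fun i => (v (j + i) : A)) hi
  have hinner : (D.operation l (fun s : Fin l => v (j + s)) : A) =
      (suspExp x).negOnePow • D.wm x := by
    refine D.coe_operation_eq_wm (a := fun s => v (j + s)) lx (fun i hi => ?_) fun i hi => ?_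
    · rw [valAt, gx i hi]
    · rw [degAt, gx i hi]
      exact hvx i hi
  have hinner_mem := D.operation_mem (p := fun i => p (j + i)) (a := fun i => v (j + i)) hvx
  set b := D.operation l (fun s : Fin l => v (j + s)) with hb
  set W := u ++ opLetter D.wm x :: y with hW
  have gW : ∀ i < j + 1 + r, W.getD i 0 = if i < j then (p i, (v i : A)) else if i = j then
      opLetter D.wm x else (p (i + l - 1), (v (i + l - 1) : A)) := fun i hi =>
    getD_replace p (fun i => (v i : A)) _ j l r i (by omega) hi
  -- the arguments of the outer operation, with the value of the inner one rescaled by its sign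
  let a : ℕ → D.harmonic := fun i => if i < j then v i else if i = j then
    (suspExp x).negOnePow • b else v (i + l - 1)
  have ha : (D.operation (j + 1 + r) (fun i => a i) : A) = (suspExp W).negOnePow • D.wm W := by
    have hbx : (((suspExp x).negOnePow • b : D.harmonic) : A) = D.wm x := by
      have h1 : (((suspExp x).negOnePow • b : D.harmonic) : A) = (suspExp x).negOnePow • (b : A) :=
        map_zsmul_unit D.harmonic.subtype _ _
      rw [h1, hinner, smul_smul, Int.units_mul_self, one_smul]
    refine D.coe_operation_eq_wm (by simp [hW, lu, ly]; omega) (fun i hi => ?_) fun i hi => ?_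
    · rw [valAt, gW i hi]
      simp only [a]
      split_ifs
      · rfl
      · exact hbx.symm
      · rfl
    · rw [degAt, gW i hi]
      simp only [a]
      split_ifs with h1 h2
      · exact hv i (by omega)
      · have h3 : (opLetter D.wm x).1 = ∑ i ∈ Finset.range l, p (j + i) + 2 - l := by
          rw [opLetter, hx, wordDeg_seqWord, length_seqWord]
        rw [h3]
        exact (D.harmonicGrading _).smul_of_tower_mem (suspExp x).negOnePow hinner_mem
      · exact hv (i + l - 1) (by omega)
  have hout : D.operation (j + 1 + r) (fun i => a i) = (suspExp x).negOnePow •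
      D.operation (j + 1 + r) (fun i : Fin (j + 1 + r) => if (i : ℕ) < j then v i
        else if (i : ℕ) = j then b else v (i + l - 1)) := by
    have h1 := (D.operation (j + 1 + r)).map_update_smul (fun i => a i) ⟨j, by omega⟩
      (((suspExp x).negOnePow : ℤ) : 𝕜) b
    have h2 : ∀ (c : D.harmonic), Function.update (fun i : Fin (j + 1 + r) => a i) ⟨j, by omega⟩ c =
        fun i : Fin (j + 1 + r) => if (i : ℕ) < j then v i
        else if (i : ℕ) = j then c else v (i + l - 1) := fun c => by
      funext i
      by_cases h : (i : ℕ) = j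
      · rw [show i = ⟨j, by omega⟩ from Fin.ext h]
        simp
      · rw [Function.update_of_ne (fun h' => h (congrArg Fin.val h'))]
        simp [a, h]
    rw [h2, h2, Int.cast_smul_eq_zsmul, Int.cast_smul_eq_zsmul] at h1
    exact h1
  have hlen : j + (l + r) + 1 - l = j + 1 + r := by omega
  rw [relTerm, hlen, ← hb]
  have hout' : D.operation (j + 1 + r) (fun i : Fin (j + 1 + r) => if (i : ℕ) < j then v i
        else if (i : ℕ) = j then b else v (i + l - 1)) =
        (suspExp x).negOnePow • D.operation (j + 1 + r) (fun i => a i) := by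
    rw [hout, smul_smul, Int.units_mul_self, one_smul]
  have hcoe : ∀ (c : ℤˣ) (z : D.harmonic), ((c • z : D.harmonic) : A) = c • (z : A) := fun c z =>
    map_zsmul_unit D.harmonic.subtype c z
  rw [hout', hcoe, hcoe, ha, hw, smul_smul, smul_smul, smul_smul, wordSign, ← Int.negOnePow_add,
    ← Int.negOnePow_add, ← Int.negOnePow_add, lu]
  congr 1
  have hdu : wordDeg u = ∑ i ∈ Finset.range j, p i := wordDeg_seqWord _ _ _
  rw [Int.negOnePow_eq_iff, hW, suspExp_append, suspExp_append, suspExp_append, suspExp, ← hdu,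
    List.length_append, List.length_cons, opLetter, lx, ly]
  push_cast
  exact ⟨r + 1, by ring⟩

lemma sum_relTerm {n : ℕ} {p : ℕ → ℤ} {v : ℕ → D.harmonic}
    (hv : ∀ i < n, v i ∈ D.harmonicGrading (p i)) :
    ∑ l ∈ Finset.Icc 1 n, ∑ j ∈ Finset.range (n + 1 - l), D.relTerm n p v l j = 0 := by
  set w := seqWord p (fun i => (v i : A)) n with hw
  have lw : w.length = n := length_seqWord _ _ _
  have hclosed : D.IsClosedWord w := by
    intro x hx
    obtain ⟨i, hi, rfl⟩ := List.mem_map.1 hx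
    exact ⟨hv i (List.mem_range.1 hi), (D.harmonic_closed (v i).2).1⟩
  have h1 : ∑ j ∈ Finset.range (n + 1), ∑ l ∈ Finset.range (n - j + 1),
      (if 2 ≤ l then D.relTerm n p v l j else 0) = 0 := by
    refine Subtype.ext ?_
    rw [AddSubmonoidClass.coe_finsetSum]
    refine Eq.trans ?_ ((congrArg ((suspExp w).negOnePow • ·) hclosed.insertOp_wm).trans
      (smul_zero _))
    rw [insertOp, units_smul_splitSum, splitSum, lw]
    refine Finset.sum_congr rfl fun j hj => ?_
    rw [AddSubmonoidClass.coe_finsetSum, units_smul_splitSum, splitSum, List.length_drop, lw]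
    refine Finset.sum_congr rfl fun l hl => ?_
    obtain ⟨r, rfl⟩ : ∃ r, n = j + (l + r) := ⟨n - j - l, by
      have := Finset.mem_range.1 hj
      have := Finset.mem_range.1 hl
      omega⟩
    have hcut : w = seqWord p (fun i => (v i : A)) j ++
        (seqWord (fun i => p (j + i)) (fun i => (v (j + i) : A)) l ++
          seqWord (fun i => p (j + (l + i))) (fun i => (v (j + (l + i)) : A)) r) := by
      rw [hw, seqWord_add, seqWord_add]
    have lu := length_seqWord p (fun i => (v i : A)) j
    have lx := length_seqWord (fun i => p (j + i)) (fun i => (v (j + i) : A)) l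
    have e1 : w.take j = seqWord p (fun i => (v i : A)) j := by
      rw [hcut]
      exact List.take_left' lu
    have e2 : w.drop j = seqWord (fun i => p (j + i)) (fun i => (v (j + i) : A)) l ++
          seqWord (fun i => p (j + (l + i))) (fun i => (v (j + (l + i)) : A)) r := by
      rw [hcut]
      exact List.drop_left' lu
    rw [e1, e2, List.take_left' lx, List.drop_left' lx, lx]
    split_ifs with h
    · rw [one_smul, hw]
      exact D.coe_relTerm h hv
    · rw [zero_smul, smul_zero]
      rfl
  rw [← h1]
  -- both sums run over the pairs `(j, l)` with `j + l ≤ n`, up to terms with `l ≤ 1`, which vanish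
  rw [Finset.sum_comm' (t' := Finset.range n) (s' := fun j => Finset.Icc 1 (n - j))
    (fun l j => by simp; omega), Finset.sum_range_succ]
  rw [Nat.sub_self, zero_add, Finset.sum_range_one, if_neg (by omega), add_zero]
  refine Finset.sum_congr rfl fun j hj => ?_
  have hj := Finset.mem_range.1 hj
  rw [Finset.sum_range_succ', if_neg (by omega), add_zero,
    show Finset.Icc 1 (n - j) = Finset.Ico 1 (n - j + 1) from rfl, Finset.sum_Ico_eq_sum_range,
    Nat.add_sub_cancel]
  refine Finset.sum_congr rfl fun l _ => ?_
  rw [add_comm 1 l]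
  split_ifs with h
  · rfl
  · obtain rfl : l = 0 := by omega
    exact D.relTerm_one n p v hj

/-- Merkulov's `A∞` structure on the harmonic elements. -/
noncomputable def merkulov : AInfinityStructure D.harmonicGrading where
  isInternal := D.isInternal_harmonicGrading
  m := D.operation
  m_zero := D.operation_eq_zero two_pos
  m_mem k _ p v hv := by
    obtain ⟨q, a, ha, hq, rfl⟩ := D.exists_extend hv
    have h := D.operation_mem ha
    rwa [← Fin.sum_univ_eq_sum_range, Finset.sum_congr rfl fun i _ => hq i] at h
  relation _ _ _ _ hv := D.sum_relTerm hv

lemma isMerkulov_merkulov : D.IsMerkulov D.merkulov := by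
  constructor
  · intro a
    change (D.operation 1 a : A) = _
    rw [D.operation_eq_zero one_lt_two, (D.harmonic_closed (a 0).2).1]
    rfl
  · intro k _ p a ha
    rw [oneSubComm_apply]
    exact congrArg _ (D.operation_apply ha)

lemma eq_merkulov {M : AInfinityStructure D.harmonicGrading} (hM : D.IsMerkulov M) :
    M = D.merkulov := by
  refine AInfinityStructure.ext_m fun k => ?_
  match k with
  | 0 => rw [M.m_zero, D.merkulov.m_zero]
  | 1 =>
    ext a
    rw [hM.1, D.isMerkulov_merkulov.1]
  | k + 2 =>
    refine D.isInternal_harmonicGrading.multilinearMap_ext fun p v hv => ?_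
    obtain ⟨q, a, ha, -, rfl⟩ := D.exists_extend hv
    refine Subtype.ext ?_
    rw [hM.2 _ (by omega) q a ha, D.isMerkulov_merkulov.2 _ (by omega) q a ha]

lemma merkulov_m_two (a b : D.harmonic) : D.merkulov.m 2 ![a, b] = D.circ a b := by
  obtain ⟨T, hT⟩ := D.exists_multilinearMap_lam 2 0
  have h2 : ∀ (p : ℕ → ℤ) (v : ℕ → A), D.lam 2 p v = v 0 * v 1 := fun p v => by rw [lam]
  have h : D.operation 2 =
      (D.harmonicProj.compMultilinearMap T).compLinearMap fun _ => D.harmonic.subtype := by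
    refine D.isInternal_harmonicGrading.multilinearMap_ext fun p v hv => ?_
    obtain ⟨q, c, hc, -, rfl⟩ := D.exists_extend hv
    rw [D.operation_apply hc, h2, ← h2 0 (fun i => (c i : A)), hT]
    rfl
  have h3 := hT (fun i => if i = 0 then (a : A) else b)
  rw [h2] at h3
  change D.operation 2 ![a, b] = D.harmonicProj (a * b)
  rw [h]
  refine congrArg D.harmonicProj (Eq.trans ?_ h3.symm)
  refine congrArg T (funext fun i => ?_)
  fin_cases i <;> rfl

end HodgeDGA

/-! ### Transport of structure -/

/-- The transport of an `A∞` structure through a linear equivalence. -/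
noncomputable def AInfinityStructure.transport {𝕜 V W : Type*} [Field 𝕜] [AddCommGroup V]
    [Module 𝕜 V] [AddCommGroup W] [Module 𝕜 W] {𝒱 : ℤ → Submodule 𝕜 V} {𝒲 : ℤ → Submodule 𝕜 W}
    (M : AInfinityStructure 𝒱) (e : V ≃ₗ[𝕜] W) (he : ∀ n, (𝒱 n).map e.toLinearMap = 𝒲 n) :
    AInfinityStructure 𝒲 where
  isInternal := by
    have h := M.isInternal.map_linearEquiv e
    simpa only [he] using h
  m k := e.toLinearMap.compMultilinearMap ((M.m k).compLinearMap fun _ => e.symm.toLinearMap)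
  m_zero := by
    ext
    simp [M.m_zero]
  m_mem k hk p v hv := by
    rw [← he]
    refine ⟨_, M.m_mem k hk p (fun i => e.symm (v i)) fun i => ?_, rfl⟩
    obtain ⟨x, hx, hxv⟩ := (he (p i)).symm ▸ hv i
    rw [← hxv]
    simpa using hx
  relation n hn p v hv := by
    have h := M.relation n hn p (fun i => e.symm (v i)) fun i hi => by
      obtain ⟨x, hx, hxv⟩ := (he (p i)).symm ▸ hv i hi
      rw [← hxv]
      simpa using hx
    have h' := congrArg e h
    rw [map_zero, map_sum] at h'
    rw [← h']
    refine Finset.sum_congr rfl fun l _ => ?_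
    rw [map_sum]
    refine Finset.sum_congr rfl fun j _ => ?_
    refine Eq.trans ?_ (map_zsmul_unit e _ _).symm
    congr 1
    simp only [LinearMap.compMultilinearMap_apply, MultilinearMap.compLinearMap_apply,
      LinearEquiv.coe_coe]
    congr 2
    funext i
    split_ifs <;> simp

theorem mainTheorem2 {𝕜 A : Type*} [RCLike 𝕜] [NonUnitalRing A] [Module 𝕜 A]
    [IsScalarTower 𝕜 A A] [SMulCommClass 𝕜 A A]
    (𝒜 : ℤ → Submodule 𝕜 A) [DirectSum.Decomposition 𝒜] [SetLike.GradedMul 𝒜]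
    (D : HodgeDGA 𝕜 𝒜) :
    -- `φ : ℋ → H(A, d)`, `a ↦ [a]`, is an isomorphism of graded vector spaces and of rings
    (Function.Bijective D.harmonicToCoh ∧
      (∀ n : ℤ, (D.harmonicGrading n).map D.harmonicToCoh = D.cohGrading n) ∧
      ∀ a b : D.harmonic,
        D.harmonicToCoh (D.circ a b) = D.cohMul (D.harmonicToCoh a) (D.harmonicToCoh b)) ∧
    -- `ℋ` carries exactly one `A∞` structure `M` given by Merkulov's formulas; its `m₂` is `∘`
    ∃ M : AInfinityStructure D.harmonicGrading,
      D.IsMerkulov M ∧ (∀ M', D.IsMerkulov M' → M' = M) ∧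
      (∀ a b : D.harmonic, M.m 2 ![a, b] = D.circ a b) ∧
      -- the structure `N` on `H(A, d)` transported from `M` along `φ`
      ∃ N : AInfinityStructure D.cohGrading,
        (∀ (k : ℕ) (a : Fin k → D.harmonic),
          N.m k (fun i => D.harmonicToCoh (a i)) = D.harmonicToCoh (M.m k a)) ∧
        N.m 1 = 0 ∧
        ∀ x y : D.Cohomology, N.m 2 ![x, y] = D.cohMul x y := by
  refine ⟨⟨D.harmonicToCoh_bijective, D.map_harmonicGrading, D.harmonicToCoh_circ⟩, D.merkulov,
    D.isMerkulov_merkulov, fun _ => D.eq_merkulov, D.merkulov_m_two, ?_⟩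
  let e : D.harmonic ≃ₗ[𝕜] D.Cohomology :=
    LinearEquiv.ofBijective D.harmonicToCoh D.harmonicToCoh_bijective
  have hN : ∀ (k : ℕ) (a : Fin k → D.harmonic),
      (D.merkulov.transport e D.map_harmonicGrading).m k (fun i => D.harmonicToCoh (a i)) =
        D.harmonicToCoh (D.merkulov.m k a) := fun k a =>
    congrArg (fun b => e (D.merkulov.m k b)) (funext fun i => e.symm_apply_apply (a i))
  refine ⟨D.merkulov.transport e D.map_harmonicGrading, hN, ?_, fun x y => ?_⟩
  · ext x
    obtain ⟨a, rfl⟩ : ∃ a : Fin 1 → D.harmonic, x = fun i => D.harmonicToCoh (a i) :=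
      ⟨fun i => e.symm (x i), funext fun i => (e.apply_symm_apply (x i)).symm⟩
    rw [hN]
    change D.harmonicToCoh (D.operation 1 a) = 0
    rw [D.operation_eq_zero one_lt_two]
    exact map_zero _
  · obtain ⟨a, rfl⟩ := D.harmonicToCoh_bijective.2 x
    obtain ⟨b, rfl⟩ := D.harmonicToCoh_bijective.2 y
    rw [← D.harmonicToCoh_circ, ← D.merkulov_m_two, ← hN]
    congr 1
    funext i
    fin_cases i <;> rfl
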